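/- **Definitions.** Let $T:X\to X$ be a map of a measurable space and let $\mathcal Y$ be a countable measurable partition of $X$ such that $T$ restricted to each $Y\in\mathcal Y$ is a measurable isomorphism onto its image. Suppose that the common refinement $\mathcal A$ of the partitions $\{T(Y),X\setminus T(Y)\}$, $Y\in\mathcal Y$, is countable. A $T$-invariant probability measure $\mu$ is *fair* if, for some such $\mathcal Y$, every measurable set $B$ contained in an element of $\mathcal A$ satisfies $\mu(Y\cap T^{-1}(B))=\mu(B)/c(B)$ for all $Y\in\mathcal Y$ with $B\subset T(Y)$, where $c(B)\in\{0,1,2,\dots,\infty\}$ is the number of such $Y$ (and $\mu(B)/\infty=0$). A map $f:[0,1]\to[0,1]$ is *countably Markov and mixing* with partition $\mathcal X$ if $\mathcal X$ is a countable partition of $[0,1]$ into nonempty open intervals $(a,b)$ (the set of which is denoted $\mathcal I$) and singletons $\{x\}$ (write $C=\{x:\{x\}\in\mathcal X\}$) such that: $f|_i$ is continuous and strictly monotone for each $i\in\mathcal I$; for all $i,j\in\mathcal I$ either $f(i)\supset j$ or $f(i)\cap j=\emptyset$; $f(C)\subset C$; and for all nonempty open $U,V\subset[0,1]$ there is $N$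 with $f^n(U)\cap V\ne\emptyset$ for all $n\ge N$. Its transition matrix $M=(m_{ij})_{i,j\in\mathcal I}$ has $m_{ij}=1$ if $f(i)\supset j$ and $m_{ij}=0$ otherwise; $\Sigma_M$ is the one-sided shift space $\{(\omega_n)_{n\ge0}\in\mathcal I^{\mathbb N}: m_{\omega_n\omega_{n+1}}=1 \text{ for all } n\}$ with the shift $\sigma$, and $c_j=\sum_{i\in\mathcal I} m_{ij}$. For a probability vector $\pi$ and a stochastic matrix $P$ on $\mathcal I$, $\mathrm{Markov}(\pi,P)$ denotes a measure on $\Sigma_M$ that gives each cylinder $[i_0\cdots i_n]$ the mass $\pi_{i_0}p_{i_0i_1}\cdots p_{i_{n-1}i_n}$. A *Lebesgue fair model* for $f$ is a map $g:[0,1]\to[0,1]$ for which Lebesgue measure is fair and such that $g\circ\phi=\phi\circ f$ for some increasing homeomorphism $\phi$ of $[0,1]$. **Theorem.** Let $f$ be a countably Markov and mixing interval map with partition $\mathcal X$ whose associated Markov shift $(\Sigma_M,\sigma)$ has a fair measure $\mathrm{Markov}(\pi,P)$. Then $f$ has exactly one Lebesgue fair model $g$. It is the piecewise affine map uniquely determined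 by the following. For $i,j\in\mathcal X$ with $i\cap f^{-1}(j)\neq\emptyset$ put $$x_{ij}=\sum_{(k,l)\in W_{ij}}\pi_kp_{kl},\qquad y_j=\sum_{l\in W_j}\pi_l,$$ $$W_{ij}=\{(k,l)\in\mathcal I\times\mathcal I:\ k\cap f^{-1}(l)\text{ is nonempty and lies to the left of } i\cap f^{-1}(j)\},$$ $$W_j=\{l\in\mathcal I:\ l\text{ lies to the left of } j\}.$$ If $i,j\in\mathcal I$, then $g$ maps $(x_{ij},\,x_{ij}+\pi_ip_{ij})\subset[0,1]$ affinely onto $(y_j,\,y_j+\pi_j)$ with the same orientation as $f|_i$. If $j$ is a singleton, then $x_{ij}\in[0,1]$ and $g(x_{ij})=y_j$. Moreover, for all $i,j\in\mathcal I$ with $i\cap f^{-1}(j)\ne\emptyset$ one has $\pi_ip_{ij}>0$, $c_j<\infty$, and the slope of the corresponding affine piece of $g$ is $c_j$ if $f|_i$ is increasing and $-c_j$ if $f|_i$ is decreasing. -/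

import Mathlib

open Set MeasureTheory
open scoped ENNReal unitInterval

noncomputable section

/-! ### Fair measures -/

/-- A countable measurable partition `𝒳` of `α` such that `T` restricted to each cell is a
measurable isomorphism onto its image. -/
structure IsBranchPartition {α : Type*} [MeasurableSpace α] (T : α → α) (𝒳 : Set (Set α)) :
    Prop where
  isPartition : Setoid.IsPartition 𝒳
  countable : 𝒳.Countable
  measurableSet : ∀ X ∈ 𝒳, MeasurableSet X
  injOn : ∀ X ∈ 𝒳, InjOn T X
  measurableSet_image : ∀ X ∈ 𝒳, ∀ B ⊆ X, MeasurableSet B → MeasurableSet (T '' B)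
  measurableSet_preimage : ∀ X ∈ 𝒳, ∀ B, MeasurableSet B → MeasurableSet (X ∩ T ⁻¹' B)

/-- The common refinement of the two-set partitions `{T(X), α \ T(X)}`, `X ∈ 𝒳`: the cell of a
point `y` is the set of the points that lie in the same sets `T(X)` as `y` does. -/
def imageRefinement {α : Type*} (T : α → α) (𝒳 : Set (Set α)) : Set (Set α) :=
  range fun y : α => {z : α | ∀ X ∈ 𝒳, z ∈ T '' X ↔ y ∈ T '' X}

/-- The number (possibly infinite) of the branches of `T⁻¹` that are defined on `B`. -/
def branchCount {α : Type*} (T : α → α) (𝒳 : Set (Set α)) (B : Set α) : ℕ∞ :=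
  {X ∈ 𝒳 | B ⊆ T '' X}.encard

/-- `μ` is a fair measure for `T`: an invariant probability measure such that the mass of each
measurable set `B` inside a cell of `imageRefinement T 𝒳` is divided equally among the pieces
`X ∩ T⁻¹(B)` of its preimage. (In `ℝ≥0∞`, a quotient by `∞` is `0`.) The refinement is required to
be countable; the notion then does not depend on the choice of `𝒳`. -/
def IsFair {α : Type*} [MeasurableSpace α] (T : α → α) (μ : Measure α) : Prop :=
  IsProbabilityMeasure μ ∧ MeasurePreserving T μ μ ∧
    ∃ 𝒳 : Set (Set α), IsBranchPartition T 𝒳 ∧ (imageRefinement T 𝒳).Countable ∧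
      ∀ A ∈ imageRefinement T 𝒳, ∀ B ⊆ A, MeasurableSet B →
        ∀ X ∈ 𝒳, B ⊆ T '' X →
          μ (X ∩ T ⁻¹' B) = μ B / ((branchCount T 𝒳 B : ℕ∞) : ℝ≥0∞)

/-! ### Countable state Markov shifts -/

/-- The one-sided Markov shift space of a matrix with entries `0` and `1`. -/
def MarkovShift {S : Type*} (M : Matrix S S ℕ) : Type _ :=
  {x : ℕ → S // ∀ n, M (x n) (x (n + 1)) = 1}

/-- The trace of the product of the discrete σ-algebras; for a countable state space this is the
Borel σ-algebra of the shift space. -/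
instance MarkovShift.measurableSpace {S : Type*} (M : Matrix S S ℕ) : MeasurableSpace (MarkovShift M) :=
  ⨆ n : ℕ, MeasurableSpace.comap (fun x : MarkovShift M => x.1 n) ⊤

/-- The shift map `(x₀, x₁, x₂, …) ↦ (x₁, x₂, …)`. -/
def shiftMap {S : Type*} (M : Matrix S S ℕ) (x : MarkovShift M) : MarkovShift M :=
  ⟨fun n => x.1 (n + 1), fun n => x.2 (n + 1)⟩

/-- The cylinder set `[w₀ w₁ ⋯ wₙ]`. -/
def shiftCylinder {S : Type*} (M : Matrix S S ℕ) (w : ℕ → S) (n : ℕ) : Set (MarkovShift M) :=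
  {x | ∀ k ≤ n, x.1 k = w k}

/-- `μ = Markov(π, P)`: `π` is a probability vector, `P` is a stochastic matrix, and
`μ [w₀ ⋯ wₙ] = π(w₀) P(w₀, w₁) ⋯ P(wₙ₋₁, wₙ)`. -/
structure IsMarkovMeasure {S : Type*} {M : Matrix S S ℕ} (π : S → ℝ) (P : Matrix S S ℝ)
    (μ : Measure (MarkovShift M)) : Prop where
  init_nonneg : ∀ i, 0 ≤ π i
  init_sum : HasSum π 1
  trans_nonneg : ∀ i j, 0 ≤ P i j
  trans_sum : ∀ i, HasSum (P i) 1
  measure_cylinder : ∀ (w : ℕ → S) (n : ℕ),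
    μ (shiftCylinder M w n) =
      ENNReal.ofReal (π (w 0) * ∏ k ∈ Finset.range n, P (w k) (w (k + 1)))

/-! ### Countably Markov and mixing interval maps -/

/-- The partition intervals. -/
def partitionIntervals (𝒳 : Set (Set I)) : Set (Set I) :=
  {i ∈ 𝒳 | ∃ a b : I, i = Ioo a b}

/-- `f : [0,1] → [0,1]` is countably Markov and mixing, with Markov partition `𝒳`. -/
structure IsCountablyMarkovMixing (f : I → I) (𝒳 : Set (Set I)) : Prop where
  isPartition : Setoid.IsPartition 𝒳
  countable : 𝒳.Countable
  interval_or_point : ∀ i ∈ 𝒳, (∃ a b : I, i = Ioo a b) ∨ ∃ x : I, i = {x}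
  continuousOn : ∀ i ∈ partitionIntervals 𝒳, ContinuousOn f i
  strictMonotone : ∀ i ∈ partitionIntervals 𝒳, StrictMonoOn f i ∨ StrictAntiOn f i
  markov : ∀ i ∈ partitionIntervals 𝒳, ∀ j ∈ partitionIntervals 𝒳,
    j ⊆ f '' i ∨ f '' i ∩ j = ∅
  points_invariant : ∀ x : I, {x} ∈ 𝒳 → {f x} ∈ 𝒳
  mixing : ∀ U V : Set I, IsOpen U → IsOpen V → U.Nonempty → V.Nonempty →
    ∃ N : ℕ, ∀ n ≥ N, (f^[n] '' U ∩ V).Nonempty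

open Classical in
/-- The transition matrix: the entry is `1` if `f(i) ⊇ j` and `0` otherwise. -/
def transitionMatrix (f : I → I) (𝒳 : Set (Set I)) :
    Matrix (partitionIntervals 𝒳) (partitionIntervals 𝒳) ℕ :=
  fun i j => if (j : Set I) ⊆ f '' (i : Set I) then 1 else 0

/-! ### Lebesgue fair models -/

/-- `g` is a Lebesgue fair model of `f`: Lebesgue measure on `[0,1]` is fair for `g`, and `g` is
conjugate to `f` by an increasing homeomorphism of `[0,1]`. -/
def IsLebesgueFairModel (f g : I → I) : Prop :=
  IsFair g (volume : Measure I) ∧ ∃ φ : I ≃ₜ I, StrictMono φ ∧ g ∘ φ = φ ∘ f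

/-- `A` lies to the left of `B`. -/
def LiesLeftOf (A B : Set I) : Prop := ∀ a ∈ A, ∀ b ∈ B, a < b

/-- The index set of the pieces `k ∩ f⁻¹(l)` to the left of `i ∩ f⁻¹(j)`. -/
def leftPieces (f : I → I) (𝒳 : Set (Set I)) (i j : Set I) :
    Set (partitionIntervals 𝒳 × partitionIntervals 𝒳) :=
  {kl | ((kl.1 : Set I) ∩ f ⁻¹' kl.2).Nonempty ∧
    LiesLeftOf ((kl.1 : Set I) ∩ f ⁻¹' kl.2) (i ∩ f ⁻¹' j)}

/-- The index set of the partition intervals to the left of `j`. -/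
def leftIntervals (𝒳 : Set (Set I)) (j : Set I) : Set (partitionIntervals 𝒳) :=
  {l | LiesLeftOf (l : Set I) j}

/-- The sum of `π k * P k l` over the pieces to the left of `i ∩ f⁻¹(j)`. -/
def pieceStart (f : I → I) (𝒳 : Set (Set I)) (π : partitionIntervals 𝒳 → ℝ)
    (P : Matrix (partitionIntervals 𝒳) (partitionIntervals 𝒳) ℝ) (i j : Set I) : ℝ :=
  ∑' kl : leftPieces f 𝒳 i j, π kl.1.1 * P kl.1.1 kl.1.2

/-- The sum of `π l` over the partition intervals to the left of `j`. -/
def cellStart (𝒳 : Set (Set I)) (π : partitionIntervals 𝒳 → ℝ) (j : Set I) : ℝ :=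
  ∑' l : leftIntervals 𝒳 j, π l.1

/-- On `(x, x') ⊆ [0,1]`, the map `g` is given by `t ↦ s * t + d`, and it maps `(x, x')`
onto `(y, y')`. -/
def MapsAffinelyOnto (g : I → I) (s d x x' y y' : ℝ) : Prop :=
  (∀ t ∈ Ioo x x', ∃ ht : t ∈ I, (g ⟨t, ht⟩ : ℝ) = s * t + d) ∧
    (fun t : ℝ => s * t + d) '' Ioo x x' = Ioo y y'

/-- `g` is the piecewise affine map described by the combinatorial data of `f`, `𝒳`, `π`, `P`. -/
structure IsPiecewiseAffineModel (f : I → I) (𝒳 : Set (Set I)) (π : partitionIntervals 𝒳 → ℝ)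
    (P : Matrix (partitionIntervals 𝒳) (partitionIntervals 𝒳) ℝ) (g : I → I) : Prop where
  on_intervals : ∀ i j : partitionIntervals 𝒳, ((i : Set I) ∩ f ⁻¹' j).Nonempty →
    ∃ s d : ℝ,
      MapsAffinelyOnto g s d
        (pieceStart f 𝒳 π P i j) (pieceStart f 𝒳 π P i j + π i * P i j)
        (cellStart 𝒳 π j) (cellStart 𝒳 π j + π j) ∧
      (StrictMonoOn f (i : Set I) → 0 < s) ∧ (StrictAntiOn f (i : Set I) → s < 0)
  on_points : ∀ i ∈ 𝒳, ∀ c : I, {c} ∈ 𝒳 → (i ∩ f ⁻¹' {c}).Nonempty →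
    ∃ t : I, (t : ℝ) = pieceStart f 𝒳 π P i {c} ∧ (g t : ℝ) = cellStart 𝒳 π {c}

end

/-! ### Fair measures: independence of the partition, and transport -/

/-! Mixing leaves no interval whose iterates all stay inside single partition intervals. Hence the
nested cylinder intervals of a symbol sequence shrink to one point, and `codedPoint` maps the shift
space to `[0,1]`. Off the countable set of points that ever hit a singleton of the partition, this
map semiconjugates the shift to `f`. The image `ν` of the Markov measure is therefore fair for `f`
(`isFair_map_codedPoint`), provided that it has no atoms; it charges every nonempty open set. Its
distribution function `φ` is then an increasing homeomorphism carrying `ν` to Lebesgue measure, and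
`g = φ ∘ f ∘ φ⁻¹` is a Lebesgue fair model.

Fairness says that `f` multiplies mass by `c_j` on each piece `i ∩ f⁻¹(j)`. Read through `φ`, this
is affinity with slope `±c_j`, and the sums defining `x_ij` and `y_j` are the masses to the left of
a piece and of a cell, that is, values of `φ` at left ends.

Atoms are excluded by `IsMarkovMeasure.exists_subsingleton_cylinder`. Along an atom the cylinder
masses decrease to a positive limit, while the ratio of `π` to these masses is a product of
integers. Since `π` is summable, some state recurs; the integer product is then constant over the
loop, which leaves no branching. A cylinder reduced to one sequence is impossible over an open
interval.

For uniqueness, any Lebesgue fair model pulls Lebesgue measure back to a nonatomic fair measure of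
`f`. By `IsFair.measure_inter_preimage` fairness does not refer to the partition used, so the
interval masses form a stationary vector of an irreducible matrix with entries `1 / c_j`. This
vector is unique (`eq_of_stationary`), fairness then gives all cylinder masses, and these determine
the measure (`fair_unique`), hence the conjugacy. -/

theorem IsBranchPartition.measurableSet_of_mem_imageRefinement {α : Type*} [MeasurableSpace α]
    {T : α → α} {𝒳 : Set (Set α)} (h : IsBranchPartition T 𝒳) {A : Set α}
    (hA : A ∈ imageRefinement T 𝒳) : MeasurableSet A := by
  obtain ⟨y, rfl⟩ := hA
  have : {z : α | ∀ X ∈ 𝒳, z ∈ T '' X ↔ y ∈ T '' X} =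
      ⋂ X ∈ 𝒳, {z : α | z ∈ T '' X ↔ y ∈ T '' X} := by
    ext z; simp
  simp only [this]
  refine MeasurableSet.biInter h.countable fun X hX => ?_
  have hm := h.measurableSet_image X hX X subset_rfl (h.measurableSet X hX)
  by_cases hy : y ∈ T '' X
  · simp only [hy, iff_true]
    exact hm
  · simp only [hy, iff_false]
    exact hm.compl

theorem pairwise_disjoint_imageRefinement {α : Type*} (T : α → α) (𝒳 : Set (Set α))
    {A A' : Set α} (hA : A ∈ imageRefinement T 𝒳) (hA' : A' ∈ imageRefinement T 𝒳) {z : α}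
    (hz : z ∈ A) (hz' : z ∈ A') : A = A' := by
  obtain ⟨y, rfl⟩ := hA
  obtain ⟨y', rfl⟩ := hA'
  ext w
  exact ⟨fun hw X hX => (hw X hX).trans ((hz X hX).symm.trans (hz' X hX)),
    fun hw X hX => (hw X hX).trans ((hz' X hX).symm.trans (hz X hX))⟩

theorem subset_image_iff_of_mem_imageRefinement {α : Type*} {T : α → α} {𝒳 : Set (Set α)}
    {A B : Set α} (hA : A ∈ imageRefinement T 𝒳) (hB : B ⊆ A) {y : α} (hy : y ∈ B) {X : Set α}
    (hX : X ∈ 𝒳) : B ⊆ T '' X ↔ y ∈ T '' X := by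
  refine ⟨fun h => h hy, fun h z hz => ?_⟩
  obtain ⟨y₀, rfl⟩ := hA
  exact (hB hz X hX).2 ((hB hy X hX).1 h)

/-- Each branch over `y` contains exactly one preimage of `y`. The count is thus intrinsic to `T`,
which is what frees fairness from the choice of partition. -/
theorem IsBranchPartition.branchCount_eq {α : Type*} [MeasurableSpace α] {T : α → α}
    {𝒳 : Set (Set α)} (h : IsBranchPartition T 𝒳) {A B : Set α}
    (hA : A ∈ imageRefinement T 𝒳) (hB : B ⊆ A) {y : α} (hy : y ∈ B) :
    branchCount T 𝒳 B = (T ⁻¹' {y}).encard := by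
  choose cell hcell huniq using fun x => h.isPartition.2 x
  have himg : {X ∈ 𝒳 | B ⊆ T '' X} = cell '' (T ⁻¹' {y}) := by
    ext X
    simp only [mem_ofPred_eq, mem_image, mem_preimage, mem_singleton_iff]
    constructor
    · rintro ⟨hX, hBX⟩
      obtain ⟨x, hx, hxy⟩ := hBX hy
      exact ⟨x, hxy, (huniq x X ⟨hX, hx⟩).symm⟩
    · rintro ⟨x, hxy, rfl⟩
      refine ⟨(hcell x).1, ?_⟩
      exact (subset_image_iff_of_mem_imageRefinement hA hB hy (hcell x).1).2
        ⟨x, (hcell x).2, hxy⟩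
  rw [branchCount, himg, InjOn.encard_image]
  intro x hx x' hx' hxx'
  refine h.injOn _ (hcell x).1 (hcell x).2 ?_ ?_
  · have := (hcell x').2
    rwa [← hxx'] at this
  · rw [mem_preimage, mem_singleton_iff] at hx hx'
    rw [hx, hx']

/-- A fair measure divides the mass of `B` equally among its preimages; no reference is made to
the partition. -/
theorem IsFair.measure_inter_preimage {α : Type*} [MeasurableSpace α] {T : α → α} {μ : Measure α}
    (h : IsFair T μ) {Z B : Set α} (hZ : MeasurableSet Z) (hB : MeasurableSet B)
    (hinj : InjOn T Z) (hBZ : B ⊆ T '' Z) {c : ℕ∞} (hc : ∀ y ∈ B, (T ⁻¹' {y}).encard = c) :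
    μ (Z ∩ T ⁻¹' B) = μ B / (c : ℝ≥0∞) := by
  obtain ⟨-, hpres, 𝒳, hP, hcount, hfair⟩ := h
  have hT := hpres.measurable
  have : Countable 𝒳 := hP.countable
  have : Countable (imageRefinement T 𝒳) := hcount
  -- Cut `Z ∩ T ⁻¹' B` by the branch of a point and the refinement cell of its image: `F` lists the
  -- pieces, `E` their images. The definition of fairness applies to each pair, and injectivity on
  -- `Z` keeps the images disjoint.
  let E : 𝒳 × imageRefinement T 𝒳 → Set α := fun p =>
    T '' ((p.1 : Set α) ∩ (Z ∩ T ⁻¹' B)) ∩ p.2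
  have hEm : ∀ p, MeasurableSet (E p) := fun p =>
    (hP.measurableSet_image p.1 p.1.2 _ inter_subset_left
      ((hP.measurableSet _ p.1.2).inter (hZ.inter (hT hB)))).inter
      (hP.measurableSet_of_mem_imageRefinement p.2.2)
  let F : 𝒳 × imageRefinement T 𝒳 → Set α := fun p => (p.1 : Set α) ∩ T ⁻¹' (E p)
  have hFm : ∀ p, MeasurableSet (F p) := fun p =>
    (hP.measurableSet _ p.1.2).inter (hT (hEm p))
  have hF : ∀ p, ∀ x ∈ F p, x ∈ (p.1 : Set α) ∧ x ∈ Z ∩ T ⁻¹' B ∧ T x ∈ (p.2 : Set α) := by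
    rintro p x ⟨hx, ⟨x', ⟨hx', hx''⟩, hxx'⟩, hA⟩
    have := hP.injOn _ p.1.2 hx' hx hxx'
    subst this
    exact ⟨hx, hx'', hA⟩
  have hcell : ∀ x x' (p p' : 𝒳 × imageRefinement T 𝒳), x ∈ (p.1 : Set α) →
      x' ∈ (p'.1 : Set α) → x = x' → T x ∈ (p.2 : Set α) → T x' ∈ (p'.2 : Set α) → p = p' := by
    rintro x _ p p' hx hx' rfl hA hA'
    refine Prod.ext (Subtype.ext ?_) (Subtype.ext ?_)
    · exact (hP.isPartition.2 x).unique ⟨p.1.2, hx⟩ ⟨p'.1.2, hx'⟩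
    · exact pairwise_disjoint_imageRefinement T 𝒳 p.2.2 p'.2.2 hA hA'
  have hFd : Pairwise (Function.onFun Disjoint F) := by
    intro p p' hpp'
    refine disjoint_left.2 fun x hx hx' => hpp' ?_
    exact hcell x x p p' (hF p x hx).1 (hF p' x hx').1 rfl (hF p x hx).2.2 (hF p' x hx').2.2
  have hEd : Pairwise (Function.onFun Disjoint E) := by
    intro p p' hpp'
    refine disjoint_left.2 ?_
    rintro _ ⟨⟨x, hx, rfl⟩, hA⟩ ⟨⟨x', hx', hxx'⟩, hA'⟩
    have := hinj hx.2.1 hx'.2.1 hxx'.symm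
    exact hpp' (hcell x x' p p' hx.1 hx'.1 this hA (by rwa [← this]))
  have hex : ∀ x ∈ Z ∩ T ⁻¹' B, ∃ p, x ∈ F p ∧ T x ∈ E p := by
    intro x hx
    obtain ⟨X, ⟨hX, hxX⟩, -⟩ := hP.isPartition.2 x
    have hE : T x ∈ E (⟨X, hX⟩, ⟨_, mem_range_self (T x)⟩) :=
      ⟨mem_image_of_mem T ⟨hxX, hx⟩, fun _ _ => Iff.rfl⟩
    exact ⟨_, ⟨hxX, hE⟩, hE⟩
  have hFU : Z ∩ T ⁻¹' B = ⋃ p, F p := by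
    ext x
    rw [mem_iUnion]
    exact ⟨fun hx => (hex x hx).imp fun p hp => hp.1, fun ⟨p, hp⟩ => (hF p x hp).2.1⟩
  have hEU : B = ⋃ p, E p := by
    ext y
    rw [mem_iUnion]
    constructor
    · intro hy
      obtain ⟨x, hx, rfl⟩ := hBZ hy
      exact (hex x ⟨hx, hy⟩).imp fun p hp => hp.2
    · rintro ⟨p, ⟨x, hx, rfl⟩, -⟩
      exact hx.2.2
  rw [hFU, measure_iUnion hFd hFm]
  conv_rhs => rw [hEU, measure_iUnion hEd hEm]
  rw [div_eq_mul_inv, ← ENNReal.tsum_mul_right]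
  refine tsum_congr fun p => ?_
  rw [← div_eq_mul_inv]
  rcases (E p).eq_empty_or_nonempty with hp | ⟨y, hy⟩
  · simp only [F, hp, preimage_empty, inter_empty, measure_empty, ENNReal.zero_div]
  · have hsub : E p ⊆ T '' p.1 := inter_subset_left.trans (image_mono inter_subset_left)
    rw [hfair p.2 p.2.2 (E p) inter_subset_right (hEm p) p.1 p.1.2 hsub,
      hP.branchCount_eq p.2.2 inter_subset_right hy, hc y]
    rw [hEU]
    exact mem_iUnion_of_mem p hy

/-- Fairness is transported by a measurable isomorphism. -/
theorem IsFair.conj {α β : Type*} [MeasurableSpace α] [MeasurableSpace β] (e : α ≃ᵐ β)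
    {T : α → α} {T' : β → β} {μ : Measure α} (hconj : ∀ x, T' (e x) = e (T x))
    (h : IsFair T μ) : IsFair T' (μ.map e) := by
  obtain ⟨hprob, hpres, 𝒳, hP, hcount, hfair⟩ := h
  have hT' : T' = e ∘ T ∘ e.symm := by
    funext y
    simpa using hconj (e.symm y)
  have himg : ∀ Y : Set β, e ⁻¹' (T' '' Y) = T '' (e ⁻¹' Y) := by
    intro Y
    ext x
    simp only [mem_preimage, mem_image, hT', Function.comp]
    constructor
    · rintro ⟨y, hy, hyx⟩
      exact ⟨e.symm y, by simpa using hy, e.injective hyx⟩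
    · rintro ⟨x', hx', rfl⟩
      exact ⟨e x', hx', by simp⟩
  have hpre : ∀ B : Set β, e ⁻¹' (T' ⁻¹' B) = T ⁻¹' (e ⁻¹' B) := by
    intro B
    ext x
    simp [hconj]
  have hinjpre : Function.Injective (preimage e : Set β → Set α) :=
    e.surjective.preimage_injective
  have hpe : ∀ X : Set α, e ⁻¹' (e.symm ⁻¹' X) = X := fun X => by
    ext x; simp
  have hmeas : ∀ B : Set β, MeasurableSet (e ⁻¹' B) ↔ MeasurableSet B := fun B =>
    e.measurableSet_preimage
  have hsub : ∀ B C : Set β, e ⁻¹' B ⊆ e ⁻¹' C ↔ B ⊆ C := fun B C =>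
    e.surjective.preimage_subset_preimage_iff
  set 𝒴 : Set (Set β) := {Y | e ⁻¹' Y ∈ 𝒳} with h𝒴
  have hB : IsBranchPartition T' 𝒴 := by
    refine ⟨⟨?_, ?_⟩, ?_, ?_, ?_, ?_, ?_⟩
    · exact hP.isPartition.1
    · intro b
      obtain ⟨X, ⟨hX, hbX⟩, hu⟩ := hP.isPartition.2 (e.symm b)
      refine ⟨e.symm ⁻¹' X, ⟨by rwa [h𝒴, mem_ofPred_eq, hpe], hbX⟩, ?_⟩
      rintro Y ⟨hY, hbY⟩
      apply hinjpre
      rw [hpe]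
      exact hu _ ⟨hY, by simpa using hbY⟩
    · exact hP.countable.preimage_of_injOn hinjpre.injOn
    · intro Y hY
      exact (hmeas Y).1 (hP.measurableSet _ hY)
    · intro Y hY y hy y' hy' hyy'
      rw [hT'] at hyy'
      have := hP.injOn _ hY (x₁ := e.symm y) (by simpa using hy) (x₂ := e.symm y')
        (by simpa using hy') (e.injective hyy')
      simpa using this
    · intro Y hY B hBY hBm
      rw [← hmeas, himg]
      exact hP.measurableSet_image _ hY _ (preimage_mono hBY) ((hmeas B).2 hBm)
    · intro Y hY B hBm
      rw [← hmeas, preimage_inter, hpre]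
      exact hP.measurableSet_preimage _ hY _ ((hmeas B).2 hBm)
  have href : ∀ A ∈ imageRefinement T' 𝒴, e ⁻¹' A ∈ imageRefinement T 𝒳 := by
    rintro _ ⟨y, rfl⟩
    refine ⟨e.symm y, ?_⟩
    ext x
    simp only [mem_ofPred_eq, mem_preimage]
    have key : ∀ Y z, z ∈ T' '' Y ↔ e.symm z ∈ T '' (e ⁻¹' Y) := fun Y z => by
      rw [← himg]; simp
    constructor
    · intro hx Y hY
      rw [key, key]
      simpa using hx _ hY
    · intro hx X hX
      have := hx (e.symm ⁻¹' X) (by rwa [h𝒴, mem_ofPred_eq, hpe])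
      rw [key, key, hpe] at this
      simpa using this
  have hbc : ∀ B : Set β, branchCount T' 𝒴 B = branchCount T 𝒳 (e ⁻¹' B) := by
    intro B
    rw [branchCount, branchCount, ← hinjpre.injOn.encard_image]
    congr 1
    ext X
    simp only [mem_image, mem_ofPred_eq]
    constructor
    · rintro ⟨Y, ⟨hY, hBY⟩, rfl⟩
      exact ⟨hY, by rw [← himg]; exact preimage_mono hBY⟩
    · rintro ⟨hX, hBX⟩
      refine ⟨e.symm ⁻¹' X, ⟨by rwa [h𝒴, mem_ofPred_eq, hpe], ?_⟩, hpe X⟩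
      rw [← hsub, himg, hpe]
      exact hBX
  have hTm : Measurable T' := by
    rw [hT']
    exact e.measurable.comp (hpres.measurable.comp e.symm.measurable)
  refine ⟨Measure.isProbabilityMeasure_map e.measurable.aemeasurable, ⟨hTm, ?_⟩, 𝒴, hB, ?_, ?_⟩
  · rw [Measure.map_map hTm e.measurable]
    have : T' ∘ e = e ∘ T := funext hconj
    rw [this, ← Measure.map_map e.measurable hpres.measurable, hpres.map_eq]
  · exact (hcount.preimage_of_injOn (f := preimage e) hinjpre.injOn).mono href
  · intro A hA B hBA hBm Y hY hBY
    rw [e.map_apply, e.map_apply, preimage_inter, hpre, hbc]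
    exact hfair _ (href A hA) _ (preimage_mono hBA) ((hmeas B).2 hBm) _ hY
      (by rw [← himg]; exact preimage_mono hBY)

/-! ### Cylinder intervals of a countably Markov and mixing interval map -/

/-- The points with some iterate in the set of the singletons of the partition. -/
def singularSet (f : I → I) (𝒳 : Set (Set I)) : Set I := {x | ∃ n, {f^[n] x} ∈ 𝒳}

/-- The set of the points whose itinerary starts with `w₀ w₁ ⋯ wₙ`. -/
def cylinderInterval (f : I → I) {𝒳 : Set (Set I)} (w : ℕ → partitionIntervals 𝒳) (n : ℕ) :
    Set I :=
  {x | ∀ k ≤ n, f^[k] x ∈ (w k : Set I)}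

theorem transitionMatrix_eq_one_iff {f : I → I} {𝒳 : Set (Set I)} {i j : partitionIntervals 𝒳} :
    transitionMatrix f 𝒳 i j = 1 ↔ (j : Set I) ⊆ f '' (i : Set I) := by
  simp [transitionMatrix]

theorem isOpen_of_mem_partitionIntervals {𝒳 : Set (Set I)} (i : partitionIntervals 𝒳) :
    IsOpen (i : Set I) := by
  obtain ⟨a, b, h⟩ := i.2.2
  rw [h]
  exact isOpen_Ioo

theorem ordConnected_of_mem_partitionIntervals {𝒳 : Set (Set I)} (i : partitionIntervals 𝒳) :
    OrdConnected (i : Set I) := by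
  obtain ⟨a, b, h⟩ := i.2.2
  rw [h]
  exact ordConnected_Ioo

theorem not_isOpen_singleton_unitInterval (x : I) : ¬ IsOpen ({x} : Set I) :=
  _root_.not_isOpen_singleton x

/-- Baire: the complement of a countable set is dense, since points of `[0,1]` are not isolated. -/
theorem Set.Countable.exists_mem_not_mem_of_isOpen {D U : Set I} (hD : D.Countable)
    (hU : IsOpen U) (hne : U.Nonempty) : ∃ x ∈ U, x ∉ D := by
  have hd : Dense (⋂ x ∈ D, ({x}ᶜ : Set I)) :=
    dense_biInter_of_isOpen (fun x _ => isOpen_compl_singleton) hD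
      fun x _ => dense_compl_singleton x
  obtain ⟨x, hx, hxU⟩ := hd.inter_open_nonempty U hU hne
  refine ⟨x, hx, fun hxD => ?_⟩
  simpa using mem_iInter₂.1 hxU x hxD

theorem Set.OrdConnected.inter_preimage_of_monotone_or_antitone {f : I → I} {s t : Set I}
    (hs : OrdConnected s) (ht : OrdConnected t) (hf : StrictMonoOn f s ∨ StrictAntiOn f s) :
    OrdConnected (s ∩ f ⁻¹' t) := by
  refine ⟨fun x hx y hy z hz => ?_⟩
  have hzs := hs.out hx.1 hy.1 hz
  refine ⟨hzs, ?_⟩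
  rcases hf with hf | hf
  · exact ht.out hx.2 hy.2 ⟨hf.monotoneOn hx.1 hzs hz.1, hf.monotoneOn hzs hy.1 hz.2⟩
  · exact ht.out hy.2 hx.2 ⟨hf.antitoneOn hzs hy.1 hz.2, hf.antitoneOn hx.1 hzs hz.1⟩

namespace IsCountablyMarkovMixing

variable {f : I → I} {𝒳 : Set (Set I)}

theorem eq_of_mem (hf : IsCountablyMarkovMixing f 𝒳) {X Y : Set I} (hX : X ∈ 𝒳) (hY : Y ∈ 𝒳)
    {x : I} (hx : x ∈ X) (hy : x ∈ Y) : X = Y :=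
  (hf.isPartition.2 x).unique ⟨hX, hx⟩ ⟨hY, hy⟩

theorem interval_eq_of_mem (hf : IsCountablyMarkovMixing f 𝒳) {i j : partitionIntervals 𝒳}
    {x : I} (hi : x ∈ (i : Set I)) (hj : x ∈ (j : Set I)) : i = j :=
  Subtype.ext (hf.eq_of_mem i.2.1 j.2.1 hi hj)

theorem nonempty (hf : IsCountablyMarkovMixing f 𝒳) {X : Set I} (hX : X ∈ 𝒳) : X.Nonempty :=
  nonempty_iff_ne_empty.2 fun h => hf.isPartition.1 (h ▸ hX)

theorem singleton_notMem (hf : IsCountablyMarkovMixing f 𝒳) {i : partitionIntervals 𝒳} {x : I}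
    (hx : x ∈ (i : Set I)) : {x} ∉ 𝒳 := fun h => by
  have := hf.eq_of_mem i.2.1 h hx rfl
  exact not_isOpen_singleton_unitInterval x (this ▸ isOpen_of_mem_partitionIntervals i)

theorem exists_interval (hf : IsCountablyMarkovMixing f 𝒳) {x : I} (hx : {x} ∉ 𝒳) :
    ∃ i : partitionIntervals 𝒳, x ∈ (i : Set I) := by
  obtain ⟨X, ⟨hX, hxX⟩, -⟩ := hf.isPartition.2 x
  rcases hf.interval_or_point X hX with h | ⟨y, rfl⟩
  · exact ⟨⟨X, hX, h⟩, hxX⟩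
  · rw [mem_singleton_iff.1 hxX] at hx
    exact absurd hX hx

theorem countable_intervals (hf : IsCountablyMarkovMixing f 𝒳) :
    Countable (partitionIntervals 𝒳) :=
  (hf.countable.mono fun _ h => h.1).to_subtype

theorem measurableSet (hf : IsCountablyMarkovMixing f 𝒳) {X : Set I} (hX : X ∈ 𝒳) :
    MeasurableSet X := by
  rcases hf.interval_or_point X hX with ⟨a, b, rfl⟩ | ⟨y, rfl⟩
  · exact measurableSet_Ioo
  · exact measurableSet_singleton y

theorem ordConnected (hf : IsCountablyMarkovMixing f 𝒳) {X : Set I} (hX : X ∈ 𝒳) :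
    OrdConnected X := by
  rcases hf.interval_or_point X hX with ⟨a, b, rfl⟩ | ⟨y, rfl⟩
  · exact ordConnected_Ioo
  · exact ordConnected_singleton

theorem injOn_interval (hf : IsCountablyMarkovMixing f 𝒳) (i : partitionIntervals 𝒳) :
    InjOn f i :=
  (hf.strictMonotone i i.2).elim StrictMonoOn.injOn StrictAntiOn.injOn

theorem injOn (hf : IsCountablyMarkovMixing f 𝒳) {X : Set I} (hX : X ∈ 𝒳) : InjOn f X := by
  rcases hf.interval_or_point X hX with h | ⟨y, rfl⟩
  · exact hf.injOn_interval ⟨X, hX, h⟩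
  · exact injOn_singleton f y

theorem countable_preimage (hf : IsCountablyMarkovMixing f 𝒳) {K : Set I} (hK : K.Countable) :
    (f ⁻¹' K).Countable := by
  have : f ⁻¹' K ⊆ ⋃ X ∈ 𝒳, X ∩ f ⁻¹' K := by
    intro x hx
    obtain ⟨X, ⟨hX, hxX⟩, -⟩ := hf.isPartition.2 x
    exact mem_biUnion hX ⟨hxX, hx⟩
  refine (hf.countable.biUnion fun X hX => ?_).mono this
  exact MapsTo.countable_of_injOn (f := f) (fun x hx => hx.2)
    ((hf.injOn hX).mono inter_subset_left) hK

theorem countable_points (hf : IsCountablyMarkovMixing f 𝒳) : {x : I | {x} ∈ 𝒳}.Countable :=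
  hf.countable.preimage_of_injOn (f := fun x : I => ({x} : Set I)) singleton_injective.injOn

theorem countable_singularSet (hf : IsCountablyMarkovMixing f 𝒳) :
    (singularSet f 𝒳).Countable := by
  have : singularSet f 𝒳 = ⋃ n, f^[n] ⁻¹' {x : I | {x} ∈ 𝒳} := by
    ext x; simp [singularSet]
  rw [this]
  refine countable_iUnion fun n => ?_
  induction n with
  | zero => exact hf.countable_points
  | succ n ih =>
    rw [Function.iterate_succ, preimage_comp]
    exact hf.countable_preimage ih

/-- That `f x` is singular whenever `x` is uses the invariance of the singletons; the converse only
adds one iterate. -/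
theorem apply_mem_singularSet_iff (hf : IsCountablyMarkovMixing f 𝒳) {x : I} :
    f x ∈ singularSet f 𝒳 ↔ x ∈ singularSet f 𝒳 := by
  constructor
  · rintro ⟨n, hn⟩
    exact ⟨n + 1, hn⟩
  · rintro ⟨n, hn⟩
    refine ⟨n, ?_⟩
    have := hf.points_invariant _ hn
    rwa [← Function.iterate_succ_apply' f n x, Function.iterate_succ_apply] at this

theorem transition_of_mem (hf : IsCountablyMarkovMixing f 𝒳) {i j : partitionIntervals 𝒳}
    {x : I} (hi : x ∈ (i : Set I)) (hj : f x ∈ (j : Set I)) : transitionMatrix f 𝒳 i j = 1 := by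
  rw [transitionMatrix_eq_one_iff]
  refine (hf.markov i i.2 j j.2).resolve_right fun h => ?_
  exact (h ▸ (⟨mem_image_of_mem f hi, hj⟩ : f x ∈ f '' i ∩ j) : f x ∈ (∅ : Set I))

/-- The sequence of the partition intervals visited by the orbit of a nonsingular point. -/
noncomputable def itinerary (hf : IsCountablyMarkovMixing f 𝒳) (x : I) (hx : x ∉ singularSet f 𝒳) :
    MarkovShift (transitionMatrix f 𝒳) :=
  ⟨fun n => (hf.exists_interval (x := f^[n] x) fun h => hx ⟨n, h⟩).choose, fun n => by
    refine hf.transition_of_mem (x := f^[n] x) ?_ ?_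
    · exact (hf.exists_interval (x := f^[n] x) fun h => hx ⟨n, h⟩).choose_spec
    · rw [← Function.iterate_succ_apply' f n x]
      exact (hf.exists_interval (x := f^[n + 1] x) fun h => hx ⟨n + 1, h⟩).choose_spec⟩

theorem mem_itinerary (hf : IsCountablyMarkovMixing f 𝒳) (x : I) (hx : x ∉ singularSet f 𝒳)
    (n : ℕ) : f^[n] x ∈ ((hf.itinerary x hx).1 n : Set I) :=
  (hf.exists_interval (x := f^[n] x) fun h => hx ⟨n, h⟩).choose_spec

theorem eq_itinerary (hf : IsCountablyMarkovMixing f 𝒳) {x : I} (hx : x ∉ singularSet f 𝒳)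
    {ω : MarkovShift (transitionMatrix f 𝒳)} (h : ∀ n, f^[n] x ∈ (ω.1 n : Set I)) :
    hf.itinerary x hx = ω :=
  Subtype.ext (funext fun n => hf.interval_eq_of_mem (hf.mem_itinerary x hx n) (h n))

theorem _root_.cylinderInterval_succ (w : ℕ → partitionIntervals 𝒳) (n : ℕ) :
    cylinderInterval f w (n + 1) =
      (w 0 : Set I) ∩ f ⁻¹' cylinderInterval f (fun k => w (k + 1)) n := by
  ext x
  simp only [cylinderInterval, mem_inter_iff, mem_preimage, mem_ofPred_eq]
  constructor
  · intro h
    exact ⟨h 0 (Nat.zero_le _), fun k hk => h (k + 1) (by omega)⟩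
  · rintro ⟨h0, h⟩ k hk
    cases k with
    | zero => exact h0
    | succ k => exact h k (by omega)

theorem _root_.cylinderInterval_zero (w : ℕ → partitionIntervals 𝒳) :
    cylinderInterval f w 0 = (w 0 : Set I) := by
  ext x
  simp [cylinderInterval]

theorem _root_.cylinderInterval_antitone (w : ℕ → partitionIntervals 𝒳) :
    Antitone (cylinderInterval f w) :=
  fun _ _ hmn _ hx k hk => hx k (hk.trans hmn)

theorem isOpen_cylinderInterval (hf : IsCountablyMarkovMixing f 𝒳)
    (w : ℕ → partitionIntervals 𝒳) (n : ℕ) : IsOpen (cylinderInterval f w n) := by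
  induction n generalizing w with
  | zero =>
    rw [cylinderInterval_zero]
    exact isOpen_of_mem_partitionIntervals _
  | succ n ih =>
    rw [cylinderInterval_succ]
    exact (hf.continuousOn _ (w 0).2).isOpen_inter_preimage
      (isOpen_of_mem_partitionIntervals _) (ih _)

theorem ordConnected_cylinderInterval (hf : IsCountablyMarkovMixing f 𝒳)
    (w : ℕ → partitionIntervals 𝒳) (n : ℕ) : OrdConnected (cylinderInterval f w n) := by
  induction n generalizing w with
  | zero =>
    rw [cylinderInterval_zero]
    exact ordConnected_of_mem_partitionIntervals _
  | succ n ih =>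
    rw [cylinderInterval_succ]
    exact (ordConnected_of_mem_partitionIntervals _).inter_preimage_of_monotone_or_antitone (ih _)
      (hf.strictMonotone _ (w 0).2)

theorem nonempty_cylinderInterval (hf : IsCountablyMarkovMixing f 𝒳)
    (ω : MarkovShift (transitionMatrix f 𝒳)) (n : ℕ) : (cylinderInterval f ω.1 n).Nonempty := by
  induction n generalizing ω with
  | zero =>
    rw [cylinderInterval_zero]
    exact hf.nonempty (ω.1 0).2.1
  | succ n ih =>
    rw [cylinderInterval_succ]
    obtain ⟨y, hy⟩ := ih (shiftMap _ ω)
    have hy' : y ∈ (ω.1 1 : Set I) := hy 0 (Nat.zero_le _)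
    obtain ⟨x, hx, rfl⟩ := transitionMatrix_eq_one_iff.1 (ω.2 0) hy'
    exact ⟨x, hx, hy⟩

theorem eq_of_mem_cylinderInterval (hf : IsCountablyMarkovMixing f 𝒳)
    {w w' : ℕ → partitionIntervals 𝒳} {n : ℕ} {x : I} (hx : x ∈ cylinderInterval f w n)
    (hx' : x ∈ cylinderInterval f w' n) : ∀ k ≤ n, w k = w' k :=
  fun k hk => hf.interval_eq_of_mem (hx k hk) (hx' k hk)

/-- A mixing map has two partition intervals. -/
theorem exists_interval_ne (hf : IsCountablyMarkovMixing f 𝒳) (i : partitionIntervals 𝒳) :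
    ∃ j : partitionIntervals 𝒳, j ≠ i := by
  by_contra! hall
  have hC : ∀ x, x ∉ (i : Set I) → {x} ∈ 𝒳 := by
    intro x hx
    by_contra h
    obtain ⟨j, hj⟩ := hf.exists_interval h
    exact hx (hall j ▸ hj)
  obtain ⟨a, b, hab⟩ := i.2.2
  have hopen : ∀ U : Set I, IsOpen U → U ∩ i = ∅ → U = ∅ := by
    intro U hU hUi
    by_contra hne
    obtain ⟨x, hx, hx'⟩ := hf.countable_points.exists_mem_not_mem_of_isOpen hU
      (nonempty_iff_ne_empty.2 hne)
    refine hx' (hC x fun h => ?_)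
    exact (hUi ▸ (⟨hx, h⟩ : x ∈ U ∩ i) : x ∈ (∅ : Set I))
  -- The complement of `i` would consist of countably many singletons, so it has no interior.
  have hi : (i : Set I) = Ioo 0 1 := by
    have ha : Iio a = ∅ := hopen _ isOpen_Iio (by
      rw [hab]; ext x; simp only [mem_inter_iff, mem_Iio, mem_Ioo, mem_empty_iff_false, iff_false]
      intro h; exact absurd h.1 (not_lt.2 h.2.1.le))
    have hb : Ioi b = ∅ := hopen _ isOpen_Ioi (by
      rw [hab]; ext x; simp only [mem_inter_iff, mem_Ioi, mem_Ioo, mem_empty_iff_false, iff_false]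
      intro h; exact absurd h.1 (not_lt.2 h.2.2.le))
    rw [Iio_eq_empty_iff] at ha
    rw [Ioi_eq_empty_iff] at hb
    rw [hab, show a = 0 from ha.eq_bot, show b = 1 from hb.eq_top]
  have hmaps : ∀ x ∈ (i : Set I), f x ∈ (i : Set I) := by
    have hlt : ∀ x ∈ (i : Set I), ∃ y ∈ (i : Set I), y < x := by
      intro x hx
      rw [hi] at hx ⊢
      obtain ⟨y, hy⟩ := exists_between hx.1
      exact ⟨y, ⟨hy.1, hy.2.trans hx.2⟩, hy.2⟩
    have hgt : ∀ x ∈ (i : Set I), ∃ y ∈ (i : Set I), x < y := by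
      intro x hx
      rw [hi] at hx ⊢
      obtain ⟨y, hy⟩ := exists_between hx.2
      exact ⟨y, ⟨hx.1.trans hy.1, hy.2⟩, hy.1⟩
    intro x hx
    obtain ⟨y, hy, hyx⟩ := hlt x hx
    obtain ⟨z, hz, hxz⟩ := hgt x hx
    conv => rw [hi]
    rcases hf.strictMonotone i i.2 with h | h
    · exact ⟨(unitInterval.nonneg _).trans_lt (h hy hx hyx),
        (h hx hz hxz).trans_le (unitInterval.le_one _)⟩
    · exact ⟨(unitInterval.nonneg _).trans_lt (h hx hz hxz),
        (h hy hx hyx).trans_le (unitInterval.le_one _)⟩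
  -- The second iterate preserves order whichever the orientation of `f`. Hence the interval bounded
  -- by `m` on the side towards which `f^[2]` moves `m` is forward invariant, and its even iterates
  -- never reach the other side.
  have hmono : StrictMonoOn f^[2] (i : Set I) := by
    intro x hx y hy hxy
    rcases hf.strictMonotone i i.2 with h | h
    · exact h (hmaps x hx) (hmaps y hy) (h hx hy hxy)
    · exact h (hmaps y hy) (hmaps x hx) (h hx hy hxy)
  obtain ⟨m, hm⟩ := hf.nonempty i.2.1
  have hm' : 0 < m ∧ m < 1 := by rwa [hi] at hm
  have main : ∀ U V : Set I, IsOpen U → IsOpen V → U.Nonempty → V.Nonempty → U ∩ V = ∅ →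
      (∀ x ∈ U, f^[2] x ∈ U) → False := by
    intro U V hU hV hUn hVn hUV hinv
    obtain ⟨N, hN⟩ := hf.mixing U V hU hV hUn hVn
    obtain ⟨_, ⟨x, hx, rfl⟩, hxV⟩ := hN (2 * N) (by omega)
    rw [Function.iterate_mul] at hxV
    have : ∀ n, (f^[2])^[n] x ∈ U := by
      intro n
      induction n with
      | zero => exact hx
      | succ n ih =>
        rw [Function.iterate_succ_apply']
        exact hinv _ ih
    exact disjoint_left.1 (disjoint_iff_inter_eq_empty.2 hUV) (this N) hxV
  have hdisj : Ioo 0 m ∩ Ioo m 1 = (∅ : Set I) := by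
    ext x
    simp only [mem_inter_iff, mem_Ioo, mem_empty_iff_false, iff_false]
    intro h
    exact absurd h.1.2 (not_lt.2 h.2.1.le)
  rcases le_total m (f^[2] m) with h | h
  · refine main (Ioo m 1) (Ioo 0 m) isOpen_Ioo isOpen_Ioo (nonempty_Ioo.2 hm'.2)
      (nonempty_Ioo.2 hm'.1) (by rw [inter_comm, hdisj]) fun x hx => ?_
    have hxi : x ∈ (i : Set I) := by rw [hi]; exact ⟨hm'.1.trans hx.1, hx.2⟩
    refine ⟨h.trans_lt (hmono hm hxi hx.1), ?_⟩
    have := hmaps _ (hmaps x hxi)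
    rw [hi] at this
    exact this.2
  · refine main (Ioo 0 m) (Ioo m 1) isOpen_Ioo isOpen_Ioo (nonempty_Ioo.2 hm'.1)
      (nonempty_Ioo.2 hm'.2) hdisj fun x hx => ?_
    have hxi : x ∈ (i : Set I) := by rw [hi]; exact ⟨hx.1, hx.2.trans hm'.2⟩
    refine ⟨?_, (hmono hxi hm hx.2).trans_le h⟩
    have := hmaps _ (hmaps x hxi)
    rw [hi] at this
    exact this.1

/-- There are no homtervals. -/
theorem eq_empty_of_subset_cylinderInterval (hf : IsCountablyMarkovMixing f 𝒳)
    (w : ℕ → partitionIntervals 𝒳) {U : Set I} (hU : IsOpen U)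
    (h : ∀ n, U ⊆ cylinderInterval f w n) : U = ∅ := by
  by_contra hne
  rw [← ne_eq, ← nonempty_iff_ne_empty] at hne
  -- By mixing, the iterates of `U` meet every `i` at all late times, yet the `n`-th one lies in the
  -- single interval `w n`. So `w` would eventually equal every state at once.
  have key : ∀ i : partitionIntervals 𝒳, ∃ N, ∀ n ≥ N, w n = i := by
    intro i
    obtain ⟨N, hN⟩ := hf.mixing U i hU (isOpen_of_mem_partitionIntervals i) hne
      (hf.nonempty i.2.1)
    refine ⟨N, fun n hn => ?_⟩
    obtain ⟨_, ⟨x, hx, rfl⟩, hi⟩ := hN n hn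
    exact hf.interval_eq_of_mem (h n hx n le_rfl) hi
  obtain ⟨j, hj⟩ := hf.exists_interval_ne (w 0)
  obtain ⟨N, hN⟩ := key (w 0)
  obtain ⟨N', hN'⟩ := key j
  exact hj ((hN' (max N N') (le_max_right _ _)).symm.trans (hN _ (le_max_left _ _)))

/-! ### The coding map -/

/-- Cantor's intersection theorem. Closures are needed because nested open intervals can have empty
intersection. -/
theorem exists_mem_closure_cylinderInterval (hf : IsCountablyMarkovMixing f 𝒳)
    (ω : MarkovShift (transitionMatrix f 𝒳)) : ∃ x, ∀ n, x ∈ closure (cylinderInterval f ω.1 n) := by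
  have := IsCompact.nonempty_iInter_of_sequence_nonempty_isCompact_isClosed
    (fun n => closure (cylinderInterval f ω.1 n))
    (fun n => closure_mono (cylinderInterval_antitone _ n.le_succ))
    (fun n => (hf.nonempty_cylinderInterval ω n).closure) isClosed_closure.isCompact
    (fun _ => isClosed_closure)
  obtain ⟨x, hx⟩ := this
  exact ⟨x, mem_iInter.1 hx⟩

/-- The point of `[0,1]` in the closures of all cylinder intervals of `ω`. -/
noncomputable def codedPoint (hf : IsCountablyMarkovMixing f 𝒳) (ω : MarkovShift (transitionMatrix f 𝒳)) : I :=
  (hf.exists_mem_closure_cylinderInterval ω).choose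

theorem codedPoint_mem_closure (hf : IsCountablyMarkovMixing f 𝒳)
    (ω : MarkovShift (transitionMatrix f 𝒳)) (n : ℕ) :
    hf.codedPoint ω ∈ closure (cylinderInterval f ω.1 n) :=
  (hf.exists_mem_closure_cylinderInterval ω).choose_spec n

theorem _root_.Set.OrdConnected.Ioo_subset_of_mem_closure {s : Set I} (hs : OrdConnected s)
    {x y : I} (hx : x ∈ closure s) (hy : y ∈ closure s) : Ioo x y ⊆ s := by
  intro z hz
  obtain ⟨a, ha, has⟩ := mem_closure_iff.1 hx (Iio z) isOpen_Iio hz.1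
  obtain ⟨b, hb, hbs⟩ := mem_closure_iff.1 hy (Ioi z) isOpen_Ioi hz.2
  exact hs.out has hbs ⟨le_of_lt ha, le_of_lt hb⟩

/-- Two such points would bound an open interval contained in every cylinder, by order convexity: a
homterval. -/
theorem eq_codedPoint (hf : IsCountablyMarkovMixing f 𝒳)
    (ω : MarkovShift (transitionMatrix f 𝒳)) {x : I}
    (hx : ∀ n, x ∈ closure (cylinderInterval f ω.1 n)) : x = hf.codedPoint ω := by
  have key : ∀ x y : I, (∀ n, x ∈ closure (cylinderInterval f ω.1 n)) →
      (∀ n, y ∈ closure (cylinderInterval f ω.1 n)) → y ≤ x := by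
    intro x y hx hy
    have := hf.eq_empty_of_subset_cylinderInterval ω.1 (U := Ioo x y) isOpen_Ioo fun n =>
      (hf.ordConnected_cylinderInterval ω.1 n).Ioo_subset_of_mem_closure (hx n) (hy n)
    rwa [Ioo_eq_empty_iff, not_lt] at this
  exact le_antisymm (key _ _ (hf.codedPoint_mem_closure ω) hx)
    (key _ _ hx (hf.codedPoint_mem_closure ω))

theorem codedPoint_itinerary (hf : IsCountablyMarkovMixing f 𝒳) (x : I)
    (hx : x ∉ singularSet f 𝒳) : hf.codedPoint (hf.itinerary x hx) = x :=
  (hf.eq_codedPoint _ fun _ => subset_closure fun k _ => hf.mem_itinerary x hx k).symm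

/-- A nonsingular point lies in the open cylinder of its own itinerary. Being also in the closure of
the cylinder of `ω`, it makes the two cylinders meet, and cylinders of equal length that meet have
the same word. -/
theorem iterate_codedPoint_mem (hf : IsCountablyMarkovMixing f 𝒳)
    (ω : MarkovShift (transitionMatrix f 𝒳)) (h : hf.codedPoint ω ∉ singularSet f 𝒳) (n : ℕ) :
    f^[n] (hf.codedPoint ω) ∈ (ω.1 n : Set I) := by
  have hmem : hf.codedPoint ω ∈ cylinderInterval f (hf.itinerary _ h).1 n :=
    fun k _ => hf.mem_itinerary _ h k
  obtain ⟨y, hy, hy'⟩ := mem_closure_iff.1 (hf.codedPoint_mem_closure ω n) _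
    (hf.isOpen_cylinderInterval _ n) hmem
  rw [← hf.eq_of_mem_cylinderInterval hy hy' n le_rfl]
  exact hf.mem_itinerary _ h n

theorem apply_codedPoint (hf : IsCountablyMarkovMixing f 𝒳)
    (ω : MarkovShift (transitionMatrix f 𝒳)) (h : hf.codedPoint ω ∉ singularSet f 𝒳) :
    f (hf.codedPoint ω) = hf.codedPoint (shiftMap _ ω) := by
  have hd : f (hf.codedPoint ω) ∉ singularSet f 𝒳 := by rwa [hf.apply_mem_singularSet_iff]
  rw [← hf.codedPoint_itinerary _ hd, hf.eq_itinerary hd (ω := shiftMap _ ω)]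
  exact fun n => hf.iterate_codedPoint_mem ω h (n + 1)

theorem exists_closure_cylinderInterval_subset (hf : IsCountablyMarkovMixing f 𝒳)
    (ω : MarkovShift (transitionMatrix f 𝒳)) {U : Set I} (hU : IsOpen U)
    (h : hf.codedPoint ω ∈ U) : ∃ n, closure (cylinderInterval f ω.1 n) ⊆ U := by
  refine exists_subset_nhds_of_isCompact (V := fun n => closure (cylinderInterval f ω.1 n))
    (directed_of_isDirected_le fun m n hmn => closure_mono (cylinderInterval_antitone _ hmn))
    (fun _ => isClosed_closure.isCompact) fun x hx => ?_
  rw [hf.eq_codedPoint ω (mem_iInter.1 hx)]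
  exact hU.mem_nhds h

/-- At most two sequences code a point. -/
theorem countable_codedPoint_preimage (hf : IsCountablyMarkovMixing f 𝒳) (c : I) :
    (hf.codedPoint ⁻¹' {c}).Countable := by
  -- An open cylinder is never reduced to `c`, so by nesting there is a side of `c` met by all
  -- cylinders of the sequence. Two sequences with the same side have overlapping cylinders next to
  -- `c` at every depth, hence coincide.
  have hsub : hf.codedPoint ⁻¹' {c} ⊆
      {ω | hf.codedPoint ω = c ∧ ∀ n, (cylinderInterval f ω.1 n ∩ Iio c).Nonempty} ∪
      {ω | hf.codedPoint ω = c ∧ ∀ n, (cylinderInterval f ω.1 n ∩ Ioi c).Nonempty} := by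
    intro ω hω
    by_contra hcon
    simp only [mem_union, mem_ofPred_eq, not_or, not_and, not_forall] at hcon
    obtain ⟨⟨m, hm⟩, ⟨n, hn⟩⟩ := And.intro (hcon.1 hω) (hcon.2 hω)
    have : cylinderInterval f ω.1 (max m n) = {c} := by
      refine (hf.nonempty_cylinderInterval ω _).subset_singleton_iff.1 fun x hx => ?_
      rcases lt_trichotomy x c with h | h | h
      · exact absurd ⟨x, cylinderInterval_antitone _ (le_max_left m n) hx, h⟩ hm
      · exact h
      · exact absurd ⟨x, cylinderInterval_antitone _ (le_max_right m n) hx, h⟩ hn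
    exact not_isOpen_singleton_unitInterval c (this ▸ hf.isOpen_cylinderInterval ω.1 _)
  refine Countable.mono hsub (Countable.union (Subsingleton.countable ?_)
    (Subsingleton.countable ?_))
  · rintro ω ⟨hω, h⟩ ω' ⟨hω', h'⟩
    refine Subtype.ext (funext fun n => ?_)
    obtain ⟨x, hx, hxc⟩ := h n
    obtain ⟨x', hx', hxc'⟩ := h' n
    obtain ⟨z, hz⟩ := exists_between (max_lt (mem_Iio.1 hxc) (mem_Iio.1 hxc'))
    refine hf.eq_of_mem_cylinderInterval (x := z) (n := n) ?_ ?_ n le_rfl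
    · refine (hf.ordConnected_cylinderInterval ω.1 n).Ioo_subset_of_mem_closure
        (subset_closure hx) (hf.codedPoint_mem_closure ω n) ?_
      rw [hω]
      exact ⟨(le_max_left _ _).trans_lt hz.1, hz.2⟩
    · refine (hf.ordConnected_cylinderInterval ω'.1 n).Ioo_subset_of_mem_closure
        (subset_closure hx') (hf.codedPoint_mem_closure ω' n) ?_
      rw [hω']
      exact ⟨(le_max_right _ _).trans_lt hz.1, hz.2⟩
  · rintro ω ⟨hω, h⟩ ω' ⟨hω', h'⟩
    refine Subtype.ext (funext fun n => ?_)
    obtain ⟨x, hx, hxc⟩ := h n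
    obtain ⟨x', hx', hxc'⟩ := h' n
    obtain ⟨z, hz⟩ := exists_between (lt_min (mem_Ioi.1 hxc) (mem_Ioi.1 hxc'))
    refine hf.eq_of_mem_cylinderInterval (x := z) (n := n) ?_ ?_ n le_rfl
    · refine (hf.ordConnected_cylinderInterval ω.1 n).Ioo_subset_of_mem_closure
        (hf.codedPoint_mem_closure ω n) (subset_closure hx) ?_
      rw [hω]
      exact ⟨hz.1, hz.2.trans_le (min_le_left _ _)⟩
    · refine (hf.ordConnected_cylinderInterval ω'.1 n).Ioo_subset_of_mem_closure
        (hf.codedPoint_mem_closure ω' n) (subset_closure hx') ?_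
      rw [hω']
      exact ⟨hz.1, hz.2.trans_le (min_le_right _ _)⟩

theorem iterate_point_mem (hf : IsCountablyMarkovMixing f 𝒳) {x : I} (hx : {x} ∈ 𝒳) (n : ℕ) :
    {f^[n] x} ∈ 𝒳 := by
  induction n with
  | zero => exact hx
  | succ n ih =>
    rw [Function.iterate_succ_apply']
    exact hf.points_invariant _ ih

/-- Irreducibility: every state can be reached from every state. -/
theorem reflTransGen_transition (hf : IsCountablyMarkovMixing f 𝒳)
    (i j : partitionIntervals 𝒳) :
    Relation.ReflTransGen (fun k l => transitionMatrix f 𝒳 k l = 1) i j := by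
  obtain ⟨N, hN⟩ := hf.mixing i j (isOpen_of_mem_partitionIntervals i)
    (isOpen_of_mem_partitionIntervals j) (hf.nonempty i.2.1) (hf.nonempty j.2.1)
  obtain ⟨_, ⟨x, hx, rfl⟩, hj⟩ := hN N le_rfl
  clear hN
  induction N generalizing i x with
  | zero =>
    rw [hf.interval_eq_of_mem hx hj]
  | succ n ih =>
    obtain ⟨k, hk⟩ := hf.exists_interval (x := f x) fun h =>
      hf.singleton_notMem hj (hf.iterate_point_mem h n)
    exact (ih k (f x) hk hj).head (hf.transition_of_mem hx hk)

end IsCountablyMarkovMixing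

/-! ### Fair Markov measures on the shift space -/

/-- The column sum of a matrix with entries `0` and `1`. -/
noncomputable def predCount {S : Type*} (M : Matrix S S ℕ) (j : S) : ℕ∞ := {i | M i j = 1}.encard

section Shift

variable {S : Type*} {M : Matrix S S ℕ}

theorem measurableSet_coord_eq (M : Matrix S S ℕ) (n : ℕ) (s : S) :
    MeasurableSet {x : MarkovShift M | x.1 n = s} :=
  (le_iSup (fun n : ℕ => MeasurableSpace.comap (fun x : MarkovShift M => x.1 n) ⊤) n) _
    ⟨{s}, trivial, rfl⟩

/-- With countably many letters there are only countably many prefixes, so `E` is a countable union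
of cylinders. -/
theorem measurableSet_of_depends_on_prefix [Countable S] {E : Set (MarkovShift M)} (n : ℕ)
    (h : ∀ x y : MarkovShift M, (∀ k ≤ n, x.1 k = y.1 k) → x ∈ E → y ∈ E) : MeasurableSet E := by
  have : E = ⋃ u ∈ {u : Fin (n + 1) → S | ∃ x ∈ E, ∀ k : Fin (n + 1), x.1 (k : ℕ) = u k},
      ⋂ k : Fin (n + 1), {y : MarkovShift M | y.1 (k : ℕ) = u k} := by
    ext y
    simp only [mem_iUnion, mem_iInter, mem_ofPred_eq]
    constructor
    · intro hy
      exact ⟨fun k => y.1 k, ⟨y, hy, fun _ => rfl⟩, fun _ => rfl⟩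
    · rintro ⟨u, ⟨x, hx, hxu⟩, hy⟩
      refine h x y (fun k hk => ?_) hx
      have h1 := hxu ⟨k, by omega⟩
      have h2 := hy ⟨k, by omega⟩
      exact h1.trans h2.symm
  rw [this]
  exact MeasurableSet.biUnion (to_countable _) fun u _ =>
    MeasurableSet.iInter fun k => measurableSet_coord_eq M k (u k)

/-- Extension of a sequence by a letter on the left. -/
def shiftCons (i : S) (y : MarkovShift M) (h : M i (y.1 0) = 1) : MarkovShift M :=
  ⟨fun n => Nat.casesOn n i y.1, fun n => by
    cases n with
    | zero => exact h
    | succ n => exact y.2 n⟩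

theorem shiftMap_injOn_cylinder (M : Matrix S S ℕ) (i : S) :
    InjOn (shiftMap M) {x | x.1 0 = i} := by
  intro x hx y hy hxy
  refine Subtype.ext (funext fun n => ?_)
  cases n with
  | zero => exact Eq.trans hx (Eq.symm hy)
  | succ n => exact congrFun (congrArg Subtype.val hxy) n

theorem encard_shiftMap_preimage (y : MarkovShift M) :
    (shiftMap M ⁻¹' {y}).encard = predCount M (y.1 0) := by
  have himg : {i | M i (y.1 0) = 1} = (fun x : MarkovShift M => x.1 0) '' (shiftMap M ⁻¹' {y}) := by
    ext i
    constructor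
    · intro hi
      exact ⟨shiftCons i y hi, rfl, rfl⟩
    · rintro ⟨x, rfl, rfl⟩
      exact x.2 0
  rw [predCount, himg, InjOn.encard_image]
  intro x hx x' hx' hxx'
  refine shiftMap_injOn_cylinder M (x'.1 0) hxx' rfl ?_
  rw [mem_preimage, mem_singleton_iff] at hx hx'
  rw [hx, hx']

theorem IsFair.shift_cylinder {μ : Measure (MarkovShift M)} (h : IsFair (shiftMap M) μ) {i j : S}
    (hij : M i j = 1) {B : Set (MarkovShift M)} (hB : MeasurableSet B)
    (hBj : ∀ x ∈ B, x.1 0 = j) :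
    μ ({x | x.1 0 = i} ∩ shiftMap M ⁻¹' B) = μ B / (predCount M j : ℝ≥0∞) := by
  refine h.measure_inter_preimage (measurableSet_coord_eq M 0 i) hB
    (shiftMap_injOn_cylinder M i) (fun y hy => ?_) fun y hy => ?_
  · exact ⟨shiftCons i y (by rw [hBj y hy, hij]), rfl, rfl⟩
  · rw [encard_shiftMap_preimage, hBj y hy]

theorem IsMarkovMeasure.measure_coord_zero {π : S → ℝ} {P : Matrix S S ℝ}
    {μ : Measure (MarkovShift M)} (hμ : IsMarkovMeasure π P μ) (i : S) :
    μ {x | x.1 0 = i} = ENNReal.ofReal (π i) := by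
  have := hμ.measure_cylinder (fun _ => i) 0
  simpa [shiftCylinder] using this

theorem IsMarkovMeasure.measure_pair {π : S → ℝ} {P : Matrix S S ℝ}
    {μ : Measure (MarkovShift M)} (hμ : IsMarkovMeasure π P μ) (i j : S) :
    μ ({x | x.1 0 = i} ∩ shiftMap M ⁻¹' {x | x.1 0 = j}) = ENNReal.ofReal (π i * P i j) := by
  have := hμ.measure_cylinder (fun n => Nat.casesOn n i fun _ => j) 1
  rw [Finset.prod_range_one] at this
  refine Eq.trans ?_ this
  congr 1
  ext x
  simp only [shiftCylinder, mem_inter_iff, mem_ofPred_eq, mem_preimage, shiftMap]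
  constructor
  · rintro ⟨h0, h1⟩ k hk
    interval_cases k
    · exact h0
    · exact h1
  · intro h
    exact ⟨h 0 (by omega), h 1 le_rfl⟩

theorem coord_pair_empty {i j : S} (h : M i j ≠ 1) :
    {x : MarkovShift M | x.1 0 = i} ∩ shiftMap M ⁻¹' {x | x.1 0 = j} = ∅ := by
  ext x
  simp only [mem_inter_iff, mem_ofPred_eq, mem_preimage, mem_empty_iff_false, iff_false, not_and]
  rintro rfl rfl
  exact h (x.2 0)

theorem IsFair.measure_pair {μ : Measure (MarkovShift M)} (h : IsFair (shiftMap M) μ) {i j : S}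
    (hij : M i j = 1) :
    μ ({x | x.1 0 = i} ∩ shiftMap M ⁻¹' {x | x.1 0 = j}) =
      μ {x | x.1 0 = j} / (predCount M j : ℝ≥0∞) :=
  h.shift_cylinder hij (measurableSet_coord_eq M 0 j) fun _ hx => hx

/-- By invariance the mass of `[j]` is the sum of the masses of the cylinders `[i j]`, so one of
these is positive. It provides a predecessor, and an infinite count would make its mass zero. -/
theorem IsFair.predCount_ne [Countable S] {μ : Measure (MarkovShift M)}
    (h : IsFair (shiftMap M) μ) {j : S} (hj : μ {x | x.1 0 = j} ≠ 0) :
    predCount M j ≠ 0 ∧ predCount M j ≠ ⊤ := by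
  have hsum : ∑' i, μ ({x | x.1 0 = i} ∩ shiftMap M ⁻¹' {x | x.1 0 = j}) =
      μ {x | x.1 0 = j} := by
    rw [← h.2.1.measure_preimage (measurableSet_coord_eq M 0 j).nullMeasurableSet,
      ← measure_iUnion]
    · congr 1
      ext x
      simp
    · intro i i' hii'
      refine disjoint_left.2 ?_
      rintro x ⟨hx, -⟩ ⟨hx', -⟩
      exact hii' (Eq.trans (Eq.symm hx) hx')
    · exact fun i => (measurableSet_coord_eq M 0 i).inter
        (h.2.1.measurable (measurableSet_coord_eq M 0 j))
  have hne : ∃ i, μ ({x | x.1 0 = i} ∩ shiftMap M ⁻¹' {x | x.1 0 = j}) ≠ 0 := by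
    by_contra! hcon
    exact hj (by rw [← hsum, ENNReal.tsum_eq_zero.2 hcon])
  obtain ⟨i, hi⟩ := hne
  have hij : M i j = 1 := by
    by_contra hij
    rw [coord_pair_empty hij] at hi
    simp at hi
  constructor
  · exact encard_ne_zero_of_mem (s := {i | M i j = 1}) hij
  · intro htop
    rw [h.measure_pair hij, htop] at hi
    simp at hi

/-- Some state has positive mass, and fairness with a finite count carries positivity backward along
every arrow; irreducibility reaches all states. -/
theorem IsFair.measure_coord_zero_ne_zero [Countable S] {μ : Measure (MarkovShift M)}
    (h : IsFair (shiftMap M) μ)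
    (hirr : ∀ i j, Relation.ReflTransGen (fun k l => M k l = 1) i j) (i : S) :
    μ {x | x.1 0 = i} ≠ 0 := by
  have hex : ∃ j, μ {x : MarkovShift M | x.1 0 = j} ≠ 0 := by
    by_contra! hcon
    have hU : (univ : Set (MarkovShift M)) = ⋃ j, {x | x.1 0 = j} := by
      ext x; simp
    have := h.1.measure_univ
    rw [hU, measure_iUnion_null hcon] at this
    exact zero_ne_one this
  obtain ⟨j, hj⟩ := hex
  induction hirr i j using Relation.ReflTransGen.head_induction_on with
  | refl => exact hj
  | @head i k hik _ ih =>
    have h2 : μ ({x | x.1 0 = i} ∩ shiftMap M ⁻¹' {x | x.1 0 = k}) ≠ 0 := by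
      rw [h.measure_pair hik]
      refine ENNReal.div_ne_zero.2 ⟨ih, ?_⟩
      simpa using (h.predCount_ne ih).2
    exact fun h0 => h2 (measure_mono_null inter_subset_left h0)

/-- Positivity and the defining relation of the transition probabilities. -/
theorem IsMarkovMeasure.fair_relation [Countable S] {π : S → ℝ} {P : Matrix S S ℝ}
    {μ : Measure (MarkovShift M)} (hμ : IsMarkovMeasure π P μ) (h : IsFair (shiftMap M) μ)
    (hirr : ∀ i j, Relation.ReflTransGen (fun k l => M k l = 1) i j) :
    (∀ i, 0 < π i) ∧ (∀ j, predCount M j ≠ 0 ∧ predCount M j ≠ ⊤) ∧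
      ∀ i j, M i j = 1 → 0 < π i * P i j ∧ π i * P i j * ((predCount M j).toNat : ℝ) = π j := by
  have hpos : ∀ i, 0 < π i := fun i => by
    have := h.measure_coord_zero_ne_zero hirr i
    rwa [hμ.measure_coord_zero, ne_eq, ENNReal.ofReal_eq_zero, not_le] at this
  have hc : ∀ j, predCount M j ≠ 0 ∧ predCount M j ≠ ⊤ := fun j =>
    h.predCount_ne (h.measure_coord_zero_ne_zero hirr j)
  refine ⟨hpos, hc, fun i j hij => ?_⟩
  have h1 := h.measure_pair hij
  have hn : ((predCount M j).toNat : ℕ∞) = predCount M j := ENat.natCast_toNat (hc j).2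
  have hn0 : (predCount M j).toNat ≠ 0 := fun h0 => (hc j).1 (by rw [← hn, h0]; rfl)
  have hR : (0 : ℝ) < (predCount M j).toNat := by exact_mod_cast Nat.pos_of_ne_zero hn0
  rw [hμ.measure_pair, hμ.measure_coord_zero, ← hn] at h1
  simp only [ENat.toENNReal_coe] at h1
  rw [← ENNReal.ofReal_natCast, ← ENNReal.ofReal_div_of_pos hR,
    ENNReal.ofReal_eq_ofReal_iff (mul_nonneg (hpos i).le (hμ.trans_nonneg i j))
      (div_nonneg (hpos j).le hR.le)] at h1
  rw [h1]
  exact ⟨div_pos (hpos j) hR, div_mul_cancel₀ _ hR.ne'⟩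

/-- An atom of a fair Markov measure lies over a periodic orbit without branching. -/
theorem IsMarkovMeasure.exists_subsingleton_cylinder [Countable S] {π : S → ℝ}
    {P : Matrix S S ℝ} {μ : Measure (MarkovShift M)} (hμ : IsMarkovMeasure π P μ)
    (h : IsFair (shiftMap M) μ)
    (hirr : ∀ i j, Relation.ReflTransGen (fun k l => M k l = 1) i j) {ω : MarkovShift M}
    (hω : μ {ω} ≠ 0) : ∃ i, {x : MarkovShift M | x.1 0 = i}.Subsingleton := by
  obtain ⟨hpos, hc, hrel⟩ := hμ.fair_relation h hirr
  have := h.1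
  set r : ℕ → ℝ := fun n => π (ω.1 0) * ∏ k ∈ Finset.range n, P (ω.1 k) (ω.1 (k + 1)) with hr
  have hrs : ∀ n, r (n + 1) = r n * P (ω.1 n) (ω.1 (n + 1)) := fun n => by
    simp only [hr, Finset.prod_range_succ, mul_assoc]
  have hP1 : ∀ i j, P i j ≤ 1 := fun i j =>
    le_hasSum (hμ.trans_sum i) j fun k _ => hμ.trans_nonneg i k
  have hlow : ∀ n, (μ {ω}).toReal ≤ r n := by
    intro n
    have hr0 : 0 ≤ r n := mul_nonneg (hpos _).le (Finset.prod_nonneg fun k _ => hμ.trans_nonneg _ _)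
    refine ENNReal.toReal_le_of_le_ofReal hr0 ?_
    rw [← hμ.measure_cylinder ω.1 n]
    refine measure_mono ?_
    rintro x rfl k _
    rfl
  have ha : 0 < (μ {ω}).toReal := ENNReal.toReal_pos hω (measure_ne_top _ _)
  have hanti : Antitone r := antitone_nat_of_succ_le fun n => by
    rw [hrs]
    exact mul_le_of_le_one_right (ha.le.trans (hlow n)) (hP1 _ _)
  have hbdd : BddBelow (range r) := ⟨_, by rintro _ ⟨n, rfl⟩; exact hlow n⟩
  set L := ⨅ n, r n with hL
  have hLpos : 0 < L := ha.trans_le (le_ciInf hlow)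
  have hLle : ∀ n, L ≤ r n := fun n => ciInf_le hbdd n
  -- The factor 2 is chosen so that, after `N`, the cylinder masses cannot drop by any integer
  -- factor other than 1.
  obtain ⟨N, hN⟩ : ∃ N, r N < 2 * L := exists_lt_of_ciInf_lt (by rw [← hL]; linarith)
  set q : ℕ → ℕ := fun n => ∏ k ∈ Finset.range n, (predCount M (ω.1 (k + 1))).toNat with hqdef
  -- Iterate the relation `π i * P i j * c_j = π j` along `ω`.
  have hq : ∀ n, π (ω.1 n) = r n * (q n : ℝ) := by
    intro n
    induction n with
    | zero => simp [hr, hqdef]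
    | succ n ih =>
      have h1 := (hrel _ _ (ω.2 n)).2
      have h2 := hpos (ω.1 n)
      rw [← h1, ih, hrs]
      simp only [hqdef, Finset.prod_range_succ]
      push_cast
      ring
  have hq1 : ∀ n, 0 < q n := by
    intro n
    refine Nat.pos_of_ne_zero fun h0 => ?_
    have := hpos (ω.1 n)
    rw [hq n] at this
    rw [h0] at this
    simp at this
  have hqd : ∀ n m, n ≤ m → q n ∣ q m := fun n m hnm =>
    Finset.prod_dvd_prod_of_subset _ _ _ (Finset.range_mono hnm)
  have hfin : {s | L ≤ π s}.Finite := by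
    have := hμ.init_sum.summable.tendsto_cofinite_zero.eventually (gt_mem_nhds hLpos)
    simpa [Filter.eventually_cofinite] using this
  -- All states visited have `π` at least `L`, so they form a finite set and one of them recurs
  -- after `N`.
  obtain ⟨n, hn, m, hm, hnm, heq⟩ := (Ici_infinite N).exists_ne_map_eq_of_mapsTo
    (f := ω.1) (fun n _ => by
      rw [mem_ofPred_eq, hq n]
      refine (hLle n).trans (le_mul_of_one_le_right (hLpos.le.trans (hLle n)) ?_)
      exact_mod_cast hq1 n) hfin
  wlog hlt : n < m generalizing n m
  · exact this m hm n hn hnm.symm heq.symm (lt_of_le_of_ne (not_lt.1 hlt) hnm.symm)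
  have hrn : r n < 2 * r m := by
    have := hanti (show N ≤ n from hn)
    have := hLle m
    linarith
  -- Since `ω n = ω m`, the products `r * q` agree at `n` and `m`. The integer `q m / q n` therefore
  -- equals `r n / r m`, which is less than 2.
  have hqq : q n = q m := by
    obtain ⟨t, ht⟩ := hqd n m hlt.le
    have e1 : r n * (q n : ℝ) = r m * (q m : ℝ) := by
      have e1 := hq n
      rw [heq, hq m] at e1
      exact e1.symm
    rw [ht] at e1
    push_cast at e1
    have hqn : (0 : ℝ) < q n := by exact_mod_cast hq1 n
    have e2 : r n = r m * t := by
      have : (r n - r m * t) * q n = 0 := by linarith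
      rcases mul_eq_zero.1 this with h0 | h0
      · linarith
      · exact absurd h0 hqn.ne'
    have hrm : 0 < r m := hLpos.trans_le (hLle m)
    have ht2 : (t : ℝ) < 2 := by
      by_contra hcon
      push Not at hcon
      have := mul_le_mul_of_nonneg_left hcon hrm.le
      linarith
    have ht2' : t < 2 := by exact_mod_cast ht2
    have ht0 : t ≠ 0 := by
      rintro rfl
      rw [mul_zero] at ht
      exact (hq1 m).ne' ht
    have : t = 1 := by omega
    rw [ht, this, mul_one]
  have hrr : r n = r m := by
    have e1 := hq n
    rw [heq, hq m, ← hqq] at e1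
    have hqn : (0 : ℝ) < q n := by exact_mod_cast hq1 n
    exact (mul_right_cancel₀ hqn.ne' e1).symm
  -- Now `r` is constant from `n` to `m`, so these transitions have probability 1. Every allowed
  -- transition has positive probability, so there is no other successor.
  have hnext : ∀ k, n ≤ k → k < m → ∀ j, M (ω.1 k) j = 1 → j = ω.1 (k + 1) := by
    intro k hk hkm j hj
    have hk1 : r k = r (k + 1) :=
      le_antisymm (((hanti hk).trans hrr.le).trans (hanti (show k + 1 ≤ m from hkm)))
        (hanti k.le_succ)
    have hPk : P (ω.1 k) (ω.1 (k + 1)) = 1 := by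
      rw [hrs] at hk1
      exact (mul_right_cancel₀ (hLpos.trans_le (hLle k)).ne'
        (by rw [one_mul, mul_comm]; exact hk1)).symm
    classical
    by_contra hne
    have hle := sum_le_hasSum {j, ω.1 (k + 1)} (fun i _ => hμ.trans_nonneg (ω.1 k) i)
      (hμ.trans_sum (ω.1 k))
    rw [Finset.sum_pair hne, hPk] at hle
    have h1 := (hrel _ _ hj).1
    have h2 := pos_of_mul_pos_right h1 (hpos _).le
    linarith
  refine ⟨ω.1 n, fun x hx y hy => Subtype.ext (funext fun t => ?_)⟩
  -- Both sequences are forced around the loop; the index `k` returns to `n` on reaching `m`.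
  suffices hs : ∃ k, n ≤ k ∧ k < m ∧ x.1 t = ω.1 k ∧ y.1 t = ω.1 k by
    obtain ⟨k, -, -, h1, h2⟩ := hs
    rw [h1, h2]
  induction t with
  | zero => exact ⟨n, le_rfl, hlt, hx, hy⟩
  | succ t ih =>
    obtain ⟨k, hk, hkm, h1, h2⟩ := ih
    have e1 := hnext k hk hkm (x.1 (t + 1)) (by rw [← h1]; exact x.2 t)
    have e2 := hnext k hk hkm (y.1 (t + 1)) (by rw [← h2]; exact y.2 t)
    rcases Nat.lt_or_ge (k + 1) m with h3 | h3
    · exact ⟨k + 1, by omega, h3, e1, e2⟩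
    · have : k + 1 = m := by omega
      rw [this, ← heq] at e1 e2
      exact ⟨n, le_rfl, hlt, e1, e2⟩

end Shift

/-! ### Absence of atoms for the fair Markov measure of an interval map. -/

namespace IsCountablyMarkovMixing

variable {f : I → I} {𝒳 : Set (Set I)}

/-- An open interval contains two nonsingular points, and coding recovers a nonsingular point from
its itinerary, so their itineraries differ. -/
theorem not_subsingleton_cylinder (hf : IsCountablyMarkovMixing f 𝒳) (i : partitionIntervals 𝒳) :
    ¬ {x : MarkovShift (transitionMatrix f 𝒳) | x.1 0 = i}.Subsingleton := by
  intro h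
  have hi := isOpen_of_mem_partitionIntervals i
  have hne := hf.nonempty i.2.1
  obtain ⟨x, hx, hxD⟩ := hf.countable_singularSet.exists_mem_not_mem_of_isOpen hi hne
  obtain ⟨y, hy, hyD⟩ :=
    (hf.countable_singularSet.insert x).exists_mem_not_mem_of_isOpen hi hne
  rw [mem_insert_iff, not_or] at hyD
  have h0 : ∀ (z : I) (hz : z ∉ singularSet f 𝒳), z ∈ (i : Set I) → (hf.itinerary z hz).1 0 = i :=
    fun z hz hzi => hf.interval_eq_of_mem (hf.mem_itinerary z hz 0) hzi
  have := h (h0 x hxD hx) (h0 y hyD.2 hy)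
  apply hyD.1
  rw [← hf.codedPoint_itinerary y hyD.2, ← this, hf.codedPoint_itinerary]

theorem measure_singleton_eq_zero (hf : IsCountablyMarkovMixing f 𝒳)
    {π : partitionIntervals 𝒳 → ℝ}
    {P : Matrix (partitionIntervals 𝒳) (partitionIntervals 𝒳) ℝ}
    {μ : Measure (MarkovShift (transitionMatrix f 𝒳))} (hμ : IsMarkovMeasure π P μ)
    (hfair : IsFair (shiftMap (transitionMatrix f 𝒳)) μ)
    (ω : MarkovShift (transitionMatrix f 𝒳)) : μ {ω} = 0 := by
  by_contra hω
  have := hf.countable_intervals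
  obtain ⟨i, hi⟩ := hμ.exists_subsingleton_cylinder hfair hf.reflTransGen_transition hω
  exact hf.not_subsingleton_cylinder i hi

end IsCountablyMarkovMixing

/-! ### Uniqueness of the stationary vector of an irreducible matrix -/

theorem ENNReal.eq_of_tsum_eq_of_le {S : Type*} {f g : S → ℝ≥0∞} (hle : ∀ i, f i ≤ g i)
    (hsum : ∑' i, g i ≤ ∑' i, f i) (hfin : ∑' i, f i ≠ ⊤) (i : S) : f i = g i := by
  by_contra hne
  exact absurd (ENNReal.tsum_lt_tsum hfin hle (lt_of_le_of_ne (hle i) hne)) (not_lt.2 hsum)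

/-- If the columns of `K` have sum one, and `K` is irreducible, then there is at most one
probability vector fixed by `K`. -/
theorem eq_of_stationary {S : Type*} {K : S → S → ℝ≥0∞} (hK : ∀ j, ∑' i, K i j = 1)
    (hirr : ∀ i j, Relation.ReflTransGen (fun k l => K k l ≠ 0) i j) {a b : S → ℝ≥0∞}
    (ha1 : ∑' i, a i = 1) (hb1 : ∑' i, b i = 1) (ha : ∀ i, ∑' j, K i j * a j = a i)
    (hb : ∀ i, ∑' j, K i j * b j = b i) : a = b := by
  by_cases hne : Nonempty S
  swap
  · exact funext fun i => (hne ⟨i⟩).elim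
  obtain ⟨i₀⟩ := hne
  wlog h0 : b i₀ ≤ a i₀ generalizing a b
  · exact (this hb1 ha1 hb ha (le_of_not_ge h0)).symm
  -- The maximum satisfies `m ≤ K m`. As `K` preserves total mass, which is finite, `m` is fixed by
  -- `K`.
  set m : S → ℝ≥0∞ := fun i => max (a i) (b i) with hm
  have hmfin : ∑' i, m i ≠ ⊤ := by
    refine ne_top_of_le_ne_top (b := ∑' i, (a i + b i)) ?_ (ENNReal.tsum_le_tsum fun i =>
      max_le le_self_add le_add_self)
    rw [ENNReal.tsum_add, ha1, hb1]
    simp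
  have hle : ∀ i, m i ≤ ∑' j, K i j * m j := by
    intro i
    refine max_le ?_ ?_
    · rw [← ha i]
      exact ENNReal.tsum_le_tsum fun j => mul_le_mul_right (le_max_left _ _) _
    · rw [← hb i]
      exact ENNReal.tsum_le_tsum fun j => mul_le_mul_right (le_max_right _ _) _
  have hsum : ∑' i, ∑' j, K i j * m j = ∑' j, m j := by
    rw [ENNReal.tsum_comm]
    refine tsum_congr fun j => ?_
    rw [ENNReal.tsum_mul_right, hK, one_mul]
  have hfix := ENNReal.eq_of_tsum_eq_of_le hle hsum.le hmfin
  have hfin : ∀ i, a i ≠ ⊤ := fun i =>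
    ne_top_of_le_ne_top (by rw [ha1]; simp) (ENNReal.le_tsum i)
  -- Equality at `k` makes the two fixed-point sums equal, hence equal term by term. Starting from
  -- `i₀`, irreducibility gives `m = a`, so `b ≤ a` with the same total mass.
  have hstep : ∀ k l, K k l ≠ 0 → m k = a k → m l = a l := by
    intro k l hkl hk
    have hk' : ∑' j, K k j * m j ≤ ∑' j, K k j * a j := by rw [ha, ← hfix, hk]
    have hterm := ENNReal.eq_of_tsum_eq_of_le (f := fun j => K k j * a j)
      (g := fun j => K k j * m j) (fun j => mul_le_mul_right (le_max_left _ _) _) hk'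
      (by rw [ha]; exact hfin k) l
    have hKle : K k l ≤ 1 := by
      rw [← hK l]
      exact ENNReal.le_tsum k
    exact ((ENNReal.mul_right_inj hkl (ne_top_of_le_ne_top ENNReal.one_ne_top hKle)).1 hterm).symm
  have hall : ∀ j, m j = a j := by
    intro j
    induction hirr i₀ j with
    | refl => exact max_eq_left h0
    | tail _ hkl ih => exact hstep _ _ hkl ih
  refine funext fun i => ?_
  refine (ENNReal.eq_of_tsum_eq_of_le (f := b) (g := a) (fun i => ?_) (by rw [ha1, hb1])
    (by rw [hb1]; simp) i).symm
  rw [← hall i]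
  exact le_max_right _ _

/-- The matrix of the backward transition probabilities of a fair measure. -/
noncomputable def backwardMatrix {S : Type*} (M : Matrix S S ℕ) (i j : S) : ℝ≥0∞ :=
  {i | M i j = 1}.indicator (fun _ => ((predCount M j : ℕ∞) : ℝ≥0∞)⁻¹) i

theorem tsum_backwardMatrix {S : Type*} {M : Matrix S S ℕ} {j : S} (h0 : predCount M j ≠ 0)
    (htop : predCount M j ≠ ⊤) : ∑' i, backwardMatrix M i j = 1 := by
  unfold backwardMatrix
  rw [← tsum_subtype, ENNReal.tsum_set_const]
  exact ENNReal.mul_inv_cancel (by simpa [predCount] using h0) (by simpa [predCount] using htop)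

namespace IsCountablyMarkovMixing

variable {f : I → I} {𝒳 : Set (Set I)}

/-! ### Fair measures of the interval map -/

theorem measurable (hf : IsCountablyMarkovMixing f 𝒳) : Measurable f := by
  intro B hB
  have : f ⁻¹' B = ⋃ X ∈ 𝒳, X ∩ f ⁻¹' B := by
    ext x
    simp only [mem_iUnion, mem_inter_iff, exists_prop]
    constructor
    · intro hx
      obtain ⟨X, ⟨hX, hxX⟩, -⟩ := hf.isPartition.2 x
      exact ⟨X, hX, hxX, hx⟩
    · rintro ⟨X, -, -, hx⟩
      exact hx
  rw [this]
  refine MeasurableSet.biUnion hf.countable fun X hX => ?_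
  rcases hf.interval_or_point X hX with h | ⟨y, rfl⟩
  · have hc := (hf.continuousOn X ⟨hX, h⟩).domRestrict.measurable hB
    have := (hf.measurableSet hX).subtype_image hc
    rwa [← Subtype.image_preimage_coe]
  · exact ((countable_singleton y).mono inter_subset_left).measurableSet

theorem measurableSet_interval (hf : IsCountablyMarkovMixing f 𝒳) (i : partitionIntervals 𝒳) :
    MeasurableSet (i : Set I) :=
  hf.measurableSet i.2.1

theorem isBranchPartition (hf : IsCountablyMarkovMixing f 𝒳) : IsBranchPartition f 𝒳 where
  isPartition := hf.isPartition
  countable := hf.countable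
  measurableSet _ hX := hf.measurableSet hX
  injOn _ hX := hf.injOn hX
  measurableSet_image _ hX _ hBX hB :=
    hB.image_of_measurable_injOn hf.measurable ((hf.injOn hX).mono hBX)
  measurableSet_preimage _ hX _ hB := (hf.measurableSet hX).inter (hf.measurable hB)

theorem interval_subset_image (hf : IsCountablyMarkovMixing f 𝒳) {i j : partitionIntervals 𝒳}
    {y : I} (hy : y ∈ (j : Set I)) (hyi : y ∈ f '' (i : Set I)) : (j : Set I) ⊆ f '' i := by
  obtain ⟨x, hx, rfl⟩ := hyi
  exact transitionMatrix_eq_one_iff.1 (hf.transition_of_mem hx hy)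

theorem encard_preimage (hf : IsCountablyMarkovMixing f 𝒳) {j : partitionIntervals 𝒳} {y : I}
    (hy : y ∈ (j : Set I)) : (f ⁻¹' {y}).encard = predCount (transitionMatrix f 𝒳) j := by
  have hx : ∀ x ∈ f ⁻¹' {y}, {x} ∉ 𝒳 := by
    rintro x rfl hx
    exact hf.singleton_notMem hy (hf.points_invariant x hx)
  have : Nonempty (partitionIntervals 𝒳) := ⟨j⟩
  choose! cell hcell using fun x (hx' : x ∈ f ⁻¹' {y}) => hf.exists_interval (hx x hx')
  have himg : {i | transitionMatrix f 𝒳 i j = 1} = cell '' (f ⁻¹' {y}) := by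
    ext i
    constructor
    · intro hi
      obtain ⟨x, hxi, hxy⟩ := transitionMatrix_eq_one_iff.1 hi hy
      exact ⟨x, hxy, hf.interval_eq_of_mem (hcell x hxy) hxi⟩
    · rintro ⟨x, hxy, rfl⟩
      refine hf.transition_of_mem (hcell x hxy) ?_
      rw [mem_preimage, mem_singleton_iff] at hxy
      rwa [hxy]
  rw [predCount, himg, InjOn.encard_image]
  intro x hx x' hx' hxx'
  refine hf.injOn_interval (cell x) (hcell x hx) (by rw [hxx']; exact hcell x' hx') ?_
  rw [mem_preimage, mem_singleton_iff] at hx hx'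
  rw [hx, hx']

theorem mem_image_iff (hf : IsCountablyMarkovMixing f 𝒳) {X Z : Set I} (hX : X ∈ 𝒳) (hZ : Z ∈ 𝒳)
    {y y' : I} (hy : y ∈ X) (hy' : y' ∈ X) (h : y ∈ f '' Z) : y' ∈ f '' Z := by
  rcases hf.interval_or_point X hX with hX' | ⟨x, rfl⟩
  · rcases hf.interval_or_point Z hZ with hZ' | ⟨z, rfl⟩
    · exact hf.interval_subset_image (i := ⟨Z, hZ, hZ'⟩) (j := ⟨X, hX, hX'⟩) hy h hy'
    · rw [image_singleton, mem_singleton_iff] at h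
      subst h
      exact absurd (hf.points_invariant z hZ)
        (hf.singleton_notMem (i := ⟨X, hX, hX'⟩) hy)
  · rw [mem_singleton_iff] at hy hy'
    rwa [hy', ← hy]

/-- By the Markov property and the invariance of the singletons, membership in an image `f '' Z`
depends only on the cell of the point (`mem_image_iff`). So each cell of `𝒳` lies in one refinement
cell. -/
theorem countable_imageRefinement (hf : IsCountablyMarkovMixing f 𝒳) :
    (imageRefinement f 𝒳).Countable := by
  set cell : I → Set I := fun y => {z | ∀ X ∈ 𝒳, z ∈ f '' X ↔ y ∈ f '' X} with hcell
  have : imageRefinement f 𝒳 ⊆ ⋃ X ∈ 𝒳, cell '' X := by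
    rintro _ ⟨y, rfl⟩
    obtain ⟨X, ⟨hX, hyX⟩, -⟩ := hf.isPartition.2 y
    exact mem_biUnion hX ⟨y, hyX, rfl⟩
  refine (hf.countable.biUnion fun X hX => Subsingleton.countable ?_).mono this
  rintro _ ⟨y, hy, rfl⟩ _ ⟨y', hy', rfl⟩
  ext z
  refine forall₂_congr fun Z hZ => ?_
  rw [show y ∈ f '' Z ↔ y' ∈ f '' Z from
    ⟨hf.mem_image_iff hX hZ hy hy', hf.mem_image_iff hX hZ hy' hy⟩]

/-- The discarded points are countably many, hence null. Taking `g = f` cuts along pieces, `g = id`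
along partition intervals. -/
theorem measure_eq_tsum_inter_preimage (hf : IsCountablyMarkovMixing f 𝒳) {ν : Measure I}
    (hν : ∀ c, ν {c} = 0) {g : I → I} (hg : Measurable g)
    (hgc : (g ⁻¹' {x | {x} ∈ 𝒳}).Countable) {E : Set I} (hE : MeasurableSet E) :
    ν E = ∑' j : partitionIntervals 𝒳, ν (E ∩ g ⁻¹' j) := by
  have := hf.countable_intervals
  have hnull : ν (g ⁻¹' {x | {x} ∈ 𝒳}) = 0 := by
    rw [← biUnion_of_singleton (g ⁻¹' {x | {x} ∈ 𝒳})]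
    exact (measure_biUnion_null_iff hgc).2 fun x _ => hν x
  rw [← measure_iUnion, ← inter_iUnion]
  · refine le_antisymm ?_ (measure_mono inter_subset_left)
    have hsub : E ⊆ (E ∩ ⋃ j : partitionIntervals 𝒳, g ⁻¹' (j : Set I)) ∪
        g ⁻¹' {x | {x} ∈ 𝒳} := by
      intro x hx
      by_cases h : {g x} ∈ 𝒳
      · exact Or.inr h
      · obtain ⟨i, hi⟩ := hf.exists_interval h
        exact Or.inl ⟨hx, mem_iUnion.2 ⟨i, hi⟩⟩
    refine (measure_mono hsub).trans ((measure_union_le _ _).trans ?_)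
    rw [hnull, add_zero]
  · intro i j hij
    refine disjoint_left.2 ?_
    rintro x ⟨-, hi⟩ ⟨-, hj⟩
    exact hij (hf.interval_eq_of_mem hi hj)
  · exact fun j => hE.inter (hg (hf.measurableSet_interval j))

/-- Cutting `B` along the partition intervals loses a null set, and singleton branches give zero on
both sides. Thus only transitions between intervals have to be tested. -/
theorem isFair_of_local (hf : IsCountablyMarkovMixing f 𝒳) {ν : Measure I}
    (hprob : IsProbabilityMeasure ν) (hpres : MeasurePreserving f ν ν) (hν : ∀ c, ν {c} = 0)
    (hloc : ∀ i j, transitionMatrix f 𝒳 i j = 1 → ∀ B, MeasurableSet B → B ⊆ (j : Set I) →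
      ν ((i : Set I) ∩ f ⁻¹' B) = ν B / (predCount (transitionMatrix f 𝒳) j : ℝ≥0∞)) :
    IsFair f ν := by
  refine ⟨hprob, hpres, 𝒳, hf.isBranchPartition, hf.countable_imageRefinement, ?_⟩
  intro A hA B hBA hB X hX hBX
  have hcp := hf.countable_points
  rcases hf.interval_or_point X hX with hX' | ⟨c, rfl⟩
  · rw [hf.measure_eq_tsum_inter_preimage hν hf.measurable (hf.countable_preimage hcp)
      ((hf.measurableSet hX).inter (hf.measurable hB)),
      hf.measure_eq_tsum_inter_preimage hν measurable_id hcp hB, div_eq_mul_inv,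
      ← ENNReal.tsum_mul_right]
    refine tsum_congr fun j => ?_
    rw [← div_eq_mul_inv, inter_assoc, ← preimage_inter, preimage_id]
    rcases (B ∩ (j : Set I)).eq_empty_or_nonempty with he | ⟨y, hyB, hyj⟩
    · simp [he]
    · have hsub := hf.interval_subset_image (i := ⟨X, hX, hX'⟩) hyj (hBX hyB)
      rw [hloc ⟨X, hX, hX'⟩ j (transitionMatrix_eq_one_iff.2 hsub) _
        (hB.inter (hf.measurableSet_interval j)) inter_subset_right,
        hf.isBranchPartition.branchCount_eq hA hBA hyB, hf.encard_preimage hyj]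
  · have h1 : ν ({c} ∩ f ⁻¹' B) = 0 := measure_mono_null inter_subset_left (hν c)
    have h2 : ν B = 0 := by
      rw [image_singleton] at hBX
      exact measure_mono_null hBX (hν _)
    rw [h1, h2, ENNReal.zero_div]

theorem fair_local (hf : IsCountablyMarkovMixing f 𝒳) {ν : Measure I} (h : IsFair f ν)
    {i j : partitionIntervals 𝒳} (hij : transitionMatrix f 𝒳 i j = 1) {B : Set I}
    (hB : MeasurableSet B) (hBj : B ⊆ (j : Set I)) :
    ν ((i : Set I) ∩ f ⁻¹' B) = ν B / (predCount (transitionMatrix f 𝒳) j : ℝ≥0∞) :=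
  h.measure_inter_preimage (hf.measurableSet_interval i) hB (hf.injOn_interval i)
    (hBj.trans (transitionMatrix_eq_one_iff.1 hij)) fun _ hy => hf.encard_preimage (hBj hy)

theorem inter_preimage_eq_empty (hf : IsCountablyMarkovMixing f 𝒳) {i j : partitionIntervals 𝒳}
    (hij : transitionMatrix f 𝒳 i j ≠ 1) : (i : Set I) ∩ f ⁻¹' j = ∅ :=
  eq_empty_of_forall_notMem fun _ hx => hij (hf.transition_of_mem hx.1 hx.2)

/-- The interval `i` splits, up to a null set, into its pieces over the `j` with `i → j`, each of
mass `ν j / c_j`. -/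
theorem fair_stationary (hf : IsCountablyMarkovMixing f 𝒳) {ν : Measure I} (h : IsFair f ν)
    (hν : ∀ c, ν {c} = 0) (i : partitionIntervals 𝒳) :
    ∑' j : partitionIntervals 𝒳, backwardMatrix (transitionMatrix f 𝒳) i j * ν j = ν i := by
  rw [hf.measure_eq_tsum_inter_preimage hν hf.measurable
    (hf.countable_preimage hf.countable_points) (hf.measurableSet_interval i)]
  refine tsum_congr fun j => ?_
  by_cases hij : transitionMatrix f 𝒳 i j = 1
  · rw [hf.fair_local h hij (hf.measurableSet_interval j) subset_rfl, backwardMatrix,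
      indicator_of_mem (by exact hij), mul_comm, div_eq_mul_inv]
  · rw [hf.inter_preimage_eq_empty hij, backwardMatrix, indicator_of_notMem (by exact hij)]
    simp

theorem countable_cylinderIntervals (hf : IsCountablyMarkovMixing f 𝒳) :
    {s : Set I | ∃ (w : ℕ → partitionIntervals 𝒳) (n : ℕ), s = cylinderInterval f w n}.Countable := by
  have := hf.countable_intervals
  have hsub : {s : Set I | ∃ (w : ℕ → partitionIntervals 𝒳) (n : ℕ), s = cylinderInterval f w n} ⊆
      ⋃ n : ℕ, range fun u : Fin (n + 1) → partitionIntervals 𝒳 =>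
        {x : I | ∀ k : Fin (n + 1), f^[(k : ℕ)] x ∈ (u k : Set I)} := by
    rintro _ ⟨w, n, rfl⟩
    refine mem_iUnion.2 ⟨n, fun k => w k, ?_⟩
    ext x
    constructor
    · exact fun h k hk => h ⟨k, by omega⟩
    · exact fun h k => h k (by omega)
  exact (countable_iUnion fun n => countable_range _).mono hsub

/-- A finite measure without atoms is determined by the masses of the cylinder intervals. -/
theorem measure_ext_of_cylinderInterval (hf : IsCountablyMarkovMixing f 𝒳) {ν ν' : Measure I}
    [IsProbabilityMeasure ν] [IsProbabilityMeasure ν'] (hν : ∀ c, ν {c} = 0)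
    (hν' : ∀ c, ν' {c} = 0)
    (h : ∀ (w : ℕ → partitionIntervals 𝒳) n, ν (cylinderInterval f w n) =
      ν' (cylinderInterval f w n)) : ν = ν' := by
  set 𝒞 : Set (Set I) := {s | ∃ (w : ℕ → partitionIntervals 𝒳) (n : ℕ), s = cylinderInterval f w n}
    with h𝒞
  -- A nonsingular point of an open set has a cylinder inside the set. Singular points have no
  -- itinerary, but they are countably many, so adding singletons to the generators suffices.
  have hgen : (inferInstance : MeasurableSpace I) =
      MeasurableSpace.generateFrom (𝒞 ∪ {s | s.Subsingleton}) := by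
    refine le_antisymm ?_ (MeasurableSpace.generateFrom_le ?_)
    · rw [BorelSpace.measurable_eq (α := I), borel]
      refine MeasurableSpace.generateFrom_le fun U hU => ?_
      have hU' : U = (⋃₀ {s ∈ 𝒞 | s ⊆ U}) ∪ ⋃ x ∈ singularSet f 𝒳 ∩ U, {x} := by
        ext x
        constructor
        · intro hx
          by_cases hxD : x ∈ singularSet f 𝒳
          · exact Or.inr (mem_biUnion (⟨hxD, hx⟩ : x ∈ singularSet f 𝒳 ∩ U) rfl)
          · obtain ⟨n, hn⟩ := hf.exists_closure_cylinderInterval_subset (hf.itinerary x hxD) hU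
              (by rwa [hf.codedPoint_itinerary])
            exact Or.inl ⟨_, ⟨⟨_, n, rfl⟩, subset_closure.trans hn⟩,
              fun k _ => hf.mem_itinerary x hxD k⟩
        · rintro (⟨s, hs, hx⟩ | hx)
          · exact hs.2 hx
          · obtain ⟨y, hy, rfl⟩ := mem_iUnion₂.1 hx
            exact hy.2
      rw [hU']
      refine MeasurableSet.union ?_ ?_
      · refine MeasurableSet.sUnion (hf.countable_cylinderIntervals.mono fun s hs => hs.1) ?_
        exact fun s hs => MeasurableSpace.measurableSet_generateFrom (Or.inl hs.1)
      · refine MeasurableSet.biUnion (hf.countable_singularSet.mono inter_subset_left) ?_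
        exact fun x _ => MeasurableSpace.measurableSet_generateFrom (Or.inr subsingleton_singleton)
    · rintro s (⟨w, n, rfl⟩ | hs)
      · exact (hf.isOpen_cylinderInterval w n).measurableSet
      · exact hs.countable.measurableSet
  have hpi : IsPiSystem (𝒞 ∪ {s | s.Subsingleton}) := by
    rintro s hs t ht ⟨x, hxs, hxt⟩
    rcases hs with ⟨w, n, rfl⟩ | hs
    swap
    · exact Or.inr (hs.anti inter_subset_left)
    rcases ht with ⟨w', n', rfl⟩ | ht
    swap
    · exact Or.inr (ht.anti inter_subset_right)
    left
    -- Cylinder intervals that meet are nested.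
    rcases le_total n n' with hnn | hnn
    · refine ⟨w', n', inter_eq_right.2 fun z hz k hk => ?_⟩
      rw [hf.eq_of_mem_cylinderInterval hxs (cylinderInterval_antitone _ hnn hxt) k hk]
      exact hz k (hk.trans hnn)
    · refine ⟨w, n, inter_eq_left.2 fun z hz k hk => ?_⟩
      rw [hf.eq_of_mem_cylinderInterval hxt (cylinderInterval_antitone _ hnn hxs) k hk]
      exact hz k (hk.trans hnn)
  refine ext_of_generate_finite _ hgen hpi ?_ (by simp)
  rintro s (⟨w, n, rfl⟩ | hs)
  · exact h w n
  · rcases hs.eq_empty_or_singleton with rfl | ⟨x, rfl⟩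
    · simp
    · rw [hν, hν']

/-- The interval map has at most one fair measure without atoms. -/
theorem fair_unique (hf : IsCountablyMarkovMixing f 𝒳)
    (hc : ∀ j, predCount (transitionMatrix f 𝒳) j ≠ 0 ∧ predCount (transitionMatrix f 𝒳) j ≠ ⊤)
    {ν ν' : Measure I} (h : IsFair f ν) (h' : IsFair f ν') (hν : ∀ c, ν {c} = 0)
    (hν' : ∀ c, ν' {c} = 0) : ν = ν' := by
  have := h.1
  have := h'.1
  have hmass : ∀ ρ : Measure I, IsProbabilityMeasure ρ → (∀ c, ρ {c} = 0) →
      ∑' i : partitionIntervals 𝒳, ρ i = 1 := by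
    intro ρ hρ hρ0
    have := hf.measure_eq_tsum_inter_preimage hρ0 measurable_id hf.countable_points
      MeasurableSet.univ
    simpa using this.symm
  have heq : (fun i : partitionIntervals 𝒳 => ν i) = fun i : partitionIntervals 𝒳 => ν' i := by
    refine eq_of_stationary (K := backwardMatrix (transitionMatrix f 𝒳))
      (fun j => tsum_backwardMatrix (hc j).1 (hc j).2) (fun i j => ?_)
      (hmass ν h.1 hν) (hmass ν' h'.1 hν') (hf.fair_stationary h hν) (hf.fair_stationary h' hν')
    refine Relation.ReflTransGen.mono (fun k l hkl => ?_) i j (hf.reflTransGen_transition i j)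
    rw [backwardMatrix, indicator_of_mem (by exact hkl)]
    simpa using (hc l).2
  -- Once the interval masses agree, fairness gives the mass of a cylinder from that of its shifted
  -- word by dividing by a column sum.
  refine hf.measure_ext_of_cylinderInterval hν hν' fun w n => ?_
  induction n generalizing w with
  | zero =>
    rw [cylinderInterval_zero]
    exact congrFun heq (w 0)
  | succ n ih =>
    rw [cylinderInterval_succ]
    have hsub : cylinderInterval f (fun k => w (k + 1)) n ⊆ (w 1 : Set I) :=
      fun x hx => hx 0 (Nat.zero_le _)
    have hm := (hf.isOpen_cylinderInterval (fun k => w (k + 1)) n).measurableSet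
    by_cases hij : transitionMatrix f 𝒳 (w 0) (w 1) = 1
    · rw [hf.fair_local h hij hm hsub, hf.fair_local h' hij hm hsub, ih]
    · rw [subset_eq_empty (inter_subset_inter_right _ (preimage_mono hsub))
        (hf.inter_preimage_eq_empty hij), measure_empty, measure_empty]

/-! ### The image of the Markov measure under the coding map -/

/-- The coded point lies in an open `U` exactly when some closed cylinder lies in `U`, a condition
on a finite prefix. -/
theorem measurable_codedPoint (hf : IsCountablyMarkovMixing f 𝒳) : Measurable hf.codedPoint := by
  have := hf.countable_intervals
  refine measurable_of_isOpen fun U hU => ?_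
  have hU' : hf.codedPoint ⁻¹' U = ⋃ n, {ω | closure (cylinderInterval f ω.1 n) ⊆ U} := by
    ext ω
    simp only [mem_preimage, mem_iUnion, mem_ofPred_eq]
    exact ⟨hf.exists_closure_cylinderInterval_subset ω hU,
      fun ⟨n, hn⟩ => hn (hf.codedPoint_mem_closure ω n)⟩
  rw [hU']
  refine MeasurableSet.iUnion fun n => measurableSet_of_depends_on_prefix n fun x y hxy hx => ?_
  have : cylinderInterval f y.1 n = cylinderInterval f x.1 n := by
    ext z
    refine forall₂_congr fun k hk => ?_
    rw [hxy k hk]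
  rw [mem_ofPred_eq, this]
  exact hx

section Coded

variable {π : partitionIntervals 𝒳 → ℝ}
  {P : Matrix (partitionIntervals 𝒳) (partitionIntervals 𝒳) ℝ}
  {μ : Measure (MarkovShift (transitionMatrix f 𝒳))}

theorem map_codedPoint_singleton (hf : IsCountablyMarkovMixing f 𝒳) (hμ : IsMarkovMeasure π P μ)
    (hfair : IsFair (shiftMap (transitionMatrix f 𝒳)) μ) (c : I) :
    μ.map hf.codedPoint {c} = 0 := by
  rw [Measure.map_apply hf.measurable_codedPoint (measurableSet_singleton c)]
  rw [← biUnion_of_singleton (hf.codedPoint ⁻¹' {c})]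
  exact (measure_biUnion_null_iff (hf.countable_codedPoint_preimage c)).2 fun ω _ =>
    hf.measure_singleton_eq_zero hμ hfair ω

theorem ae_codedPoint_notMem (hf : IsCountablyMarkovMixing f 𝒳) (hμ : IsMarkovMeasure π P μ)
    (hfair : IsFair (shiftMap (transitionMatrix f 𝒳)) μ) :
    ∀ᵐ ω ∂μ, hf.codedPoint ω ∉ singularSet f 𝒳 := by
  rw [ae_iff]
  simp only [not_not]
  have : {ω | hf.codedPoint ω ∈ singularSet f 𝒳} =
      ⋃ c ∈ singularSet f 𝒳, hf.codedPoint ⁻¹' {c} := by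
    ext; simp
  rw [this]
  refine (measure_biUnion_null_iff hf.countable_singularSet).2 fun c _ => ?_
  rw [← Measure.map_apply hf.measurable_codedPoint (measurableSet_singleton c)]
  exact hf.map_codedPoint_singleton hμ hfair c

/-- Almost surely the coded point is nonsingular. Then its partition interval is the first letter,
and coding intertwines the shift with `f`. -/
theorem map_codedPoint_inter_preimage (hf : IsCountablyMarkovMixing f 𝒳)
    (hμ : IsMarkovMeasure π P μ) (hfair : IsFair (shiftMap (transitionMatrix f 𝒳)) μ)
    (i : partitionIntervals 𝒳) {B : Set I} (hB : MeasurableSet B) :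
    μ.map hf.codedPoint ((i : Set I) ∩ f ⁻¹' B) =
      μ ({x | x.1 0 = i} ∩ shiftMap _ ⁻¹' (hf.codedPoint ⁻¹' B)) := by
  rw [Measure.map_apply hf.measurable_codedPoint
    ((hf.measurableSet_interval i).inter (hf.measurable hB))]
  refine measure_congr ?_
  filter_upwards [hf.ae_codedPoint_notMem hμ hfair] with ω hω
  refine propext ?_
  have h0 := hf.iterate_codedPoint_mem ω hω 0
  change (hf.codedPoint ω ∈ (i : Set I) ∧ f (hf.codedPoint ω) ∈ B) ↔
    (ω.1 0 = i ∧ hf.codedPoint (shiftMap _ ω) ∈ B)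
  rw [hf.apply_codedPoint ω hω]
  refine and_congr_left fun _ => ⟨fun h => hf.interval_eq_of_mem h0 h, fun h => ?_⟩
  rw [← h]
  exact h0

theorem map_codedPoint_interval (hf : IsCountablyMarkovMixing f 𝒳)
    (hμ : IsMarkovMeasure π P μ) (hfair : IsFair (shiftMap (transitionMatrix f 𝒳)) μ)
    (i : partitionIntervals 𝒳) :
    μ.map hf.codedPoint i = ENNReal.ofReal (π i) := by
  have := hf.map_codedPoint_inter_preimage hμ hfair i MeasurableSet.univ
  simp only [preimage_univ, inter_univ] at this
  rw [this, hμ.measure_coord_zero]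

theorem measurePreserving_map_codedPoint (hf : IsCountablyMarkovMixing f 𝒳)
    (hμ : IsMarkovMeasure π P μ) (hfair : IsFair (shiftMap (transitionMatrix f 𝒳)) μ) :
    MeasurePreserving f (μ.map hf.codedPoint) (μ.map hf.codedPoint) := by
  refine ⟨hf.measurable, ?_⟩
  rw [Measure.map_map hf.measurable hf.measurable_codedPoint]
  have : f ∘ hf.codedPoint =ᵐ[μ] hf.codedPoint ∘ shiftMap _ := by
    filter_upwards [hf.ae_codedPoint_notMem hμ hfair] with ω hω
    exact hf.apply_codedPoint ω hω
  rw [Measure.map_congr this, ← Measure.map_map hf.measurable_codedPoint hfair.2.1.measurable,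
    hfair.2.1.map_eq]

theorem isFair_map_codedPoint (hf : IsCountablyMarkovMixing f 𝒳)
    (hμ : IsMarkovMeasure π P μ) (hfair : IsFair (shiftMap (transitionMatrix f 𝒳)) μ) :
    IsFair f (μ.map hf.codedPoint) := by
  have := hfair.1
  refine hf.isFair_of_local (Measure.isProbabilityMeasure_map hf.measurable_codedPoint.aemeasurable)
    (hf.measurePreserving_map_codedPoint hμ hfair) (hf.map_codedPoint_singleton hμ hfair) ?_
  intro i j hij B hB hBj
  have hae : hf.codedPoint ⁻¹' B =ᵐ[μ] (hf.codedPoint ⁻¹' B ∩ {x | x.1 0 = j} : Set _) := by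
    filter_upwards [hf.ae_codedPoint_notMem hμ hfair] with ω hω
    refine propext ⟨fun h => ⟨h, ?_⟩, fun h => h.1⟩
    exact hf.interval_eq_of_mem (hf.iterate_codedPoint_mem ω hω 0) (hBj h)
  have hm : MeasurableSet (hf.codedPoint ⁻¹' B ∩ {x | x.1 0 = j}) :=
    (hf.measurable_codedPoint hB).inter (measurableSet_coord_eq _ 0 j)
  rw [hf.map_codedPoint_inter_preimage hμ hfair i hB,
    Measure.map_apply hf.measurable_codedPoint hB, measure_congr hae,
    ← hfair.shift_cylinder hij hm fun x hx => hx.2]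
  refine measure_congr (Filter.EventuallyEq.rfl.inter ?_)
  exact hfair.2.1.quasiMeasurePreserving.preimage_ae_eq hae

/-- Around a nonsingular point, `U` contains a closed cylinder interval, and hence the coded image
of a shift cylinder. The mass of that cylinder is a product of positive numbers. -/
theorem map_codedPoint_pos (hf : IsCountablyMarkovMixing f 𝒳)
    (hμ : IsMarkovMeasure π P μ) (hfair : IsFair (shiftMap (transitionMatrix f 𝒳)) μ) {U : Set I}
    (hU : IsOpen U) (hne : U.Nonempty) : 0 < μ.map hf.codedPoint U := by
  have := hf.countable_intervals
  obtain ⟨hpos, -, hrel⟩ := hμ.fair_relation hfair hf.reflTransGen_transition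
  obtain ⟨x, hx, hxD⟩ := hf.countable_singularSet.exists_mem_not_mem_of_isOpen hU hne
  set ω := hf.itinerary x hxD with hω
  obtain ⟨n, hn⟩ := hf.exists_closure_cylinderInterval_subset ω hU
    (by rwa [hω, hf.codedPoint_itinerary])
  rw [Measure.map_apply hf.measurable_codedPoint hU.measurableSet]
  refine lt_of_lt_of_le ?_ (measure_mono (s := shiftCylinder _ ω.1 n) fun ω' hω' => ?_)
  · rw [hμ.measure_cylinder, ENNReal.ofReal_pos]
    refine mul_pos (hpos _) (Finset.prod_pos fun k _ => ?_)
    exact pos_of_mul_pos_right (hrel _ _ (ω.2 k)).1 (hpos _).le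
  · refine hn ?_
    have : cylinderInterval f ω.1 n = cylinderInterval f ω'.1 n := by
      ext z
      refine forall₂_congr fun k hk => ?_
      rw [hω' k hk]
    rw [this]
    exact hf.codedPoint_mem_closure ω' n

end Coded

end IsCountablyMarkovMixing

/-! ### The distribution function of a nonatomic measure of full support -/

/-- Since `ν` alone determines `φ`, uniqueness of the measure yields uniqueness of the conjugacy. -/
theorem coe_eq_measureReal_Iic {ν : Measure I} {φ : I ≃ₜ I} (hφ : StrictMono φ)
    (hmap : ν.map φ = volume) (x : I) : (φ x : ℝ) = ν.real (Iic x) := by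
  have hpre : φ ⁻¹' Iic (φ x) = Iic x := by
    ext y
    simp [hφ.le_iff_le]
  have h := Measure.map_apply (μ := ν) φ.measurable (measurableSet_Iic (a := φ x))
  rw [hpre, hmap, unitInterval.volume_Iic] at h
  rw [measureReal_def, ← h, ENNReal.toReal_ofReal (unitInterval.nonneg _)]

/-- The distribution function works: absence of atoms makes it continuous with value 0 at 0, and
full support makes it strictly increasing. -/
theorem exists_homeomorph_map_eq_volume {ν : Measure I} [IsProbabilityMeasure ν]
    (hν : ∀ c, ν {c} = 0) (hpos : ∀ U : Set I, IsOpen U → U.Nonempty → 0 < ν U) :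
    ∃ φ : I ≃ₜ I, StrictMono φ ∧ ν.map φ = volume := by
  set ρ : Measure ℝ := ν.map Subtype.val with hρ
  have hρp : IsProbabilityMeasure ρ :=
    Measure.isProbabilityMeasure_map measurable_subtype_coe.aemeasurable
  have hcdf : ∀ x : I, ProbabilityTheory.cdf ρ x = ν.real (Iic x) := by
    intro x
    rw [ProbabilityTheory.cdf_eq_real, measureReal_def, hρ,
      Measure.map_apply measurable_subtype_coe measurableSet_Iic]
    rfl
  have hcont : Continuous (ProbabilityTheory.cdf ρ) := by
    refine continuous_iff_continuousAt.2 fun x => ?_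
    have hmono := ProbabilityTheory.monotone_cdf ρ
    rw [hmono.continuousAt_iff_leftLim_eq_rightLim, StieltjesFunction.rightLim_eq]
    refine le_antisymm (hmono.leftLim_le le_rfl) ?_
    have h1 : ρ {x} = 0 := by
      rw [hρ, Measure.map_apply measurable_subtype_coe (measurableSet_singleton x)]
      by_cases hx : x ∈ I
      · have : (Subtype.val ⁻¹' {x} : Set I) = {⟨x, hx⟩} := by
          ext y; simp [Subtype.ext_iff]
        rw [this, hν]
      · have : (Subtype.val ⁻¹' {x} : Set I) = ∅ := by
          ext y
          simp only [mem_preimage, mem_singleton_iff, mem_empty_iff_false, iff_false]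
          rintro rfl
          exact hx y.2
        rw [this, measure_empty]
    have h2 := (ProbabilityTheory.cdf ρ).measure_singleton x
    rw [ProbabilityTheory.measure_cdf, h1] at h2
    linarith [ENNReal.ofReal_eq_zero.1 h2.symm]
  set F : I → I := fun x => ⟨ProbabilityTheory.cdf ρ x, ProbabilityTheory.cdf_nonneg ρ x,
    ProbabilityTheory.cdf_le_one ρ x⟩ with hF
  have hFc : Continuous F := (hcont.comp continuous_subtype_val).subtype_mk _
  have hFm : StrictMono F := by
    intro x y hxy
    change ProbabilityTheory.cdf ρ x < ProbabilityTheory.cdf ρ y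
    rw [hcdf, hcdf]
    have h1 : 0 < ν.real (Ioo x y) :=
      ENNReal.toReal_pos (hpos _ isOpen_Ioo (nonempty_Ioo.2 hxy)).ne' (measure_ne_top _ _)
    have h2 : ν.real (Iic x) + ν.real (Ioo x y) = ν.real (Iic x ∪ Ioo x y) :=
      (measureReal_union (disjoint_left.2 fun z hz hz' => not_lt.2 hz hz'.1)
        measurableSet_Ioo).symm
    have h3 : ν.real (Iic x ∪ Ioo x y) ≤ ν.real (Iic y) :=
      measureReal_mono (union_subset (Iic_subset_Iic.2 hxy.le) fun z hz => hz.2.le)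
    linarith
  have hF0 : F 0 = 0 := by
    refine Subtype.ext ?_
    change ProbabilityTheory.cdf ρ (0 : I) = 0
    have : Iic (0 : I) = {0} := Iic_bot
    rw [hcdf, this, measureReal_def, hν, ENNReal.toReal_zero]
  have hF1 : F 1 = 1 := by
    refine Subtype.ext ?_
    change ProbabilityTheory.cdf ρ (1 : I) = 1
    have : Iic (1 : I) = univ := Iic_top
    rw [hcdf, this, probReal_univ]
  have hFs : Function.Surjective F := by
    intro y
    have := intermediate_value_Icc (α := I) (f := F) zero_le_one hFc.continuousOn
    rw [hF0, hF1] at this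
    obtain ⟨x, -, hx⟩ := this ⟨unitInterval.nonneg y, unitInterval.le_one y⟩
    exact ⟨x, hx⟩
  set φ : I ≃ₜ I := (hFm.orderIsoOfSurjective F hFs).toHomeomorph with hφ
  have hφF : ∀ x, φ x = F x := fun x => rfl
  have hφm : StrictMono φ := hFm
  refine ⟨φ, hφm, ?_⟩
  have hprob : IsProbabilityMeasure (ν.map φ) :=
    Measure.isProbabilityMeasure_map φ.measurable.aemeasurable
  refine Measure.ext_of_Iic _ _ fun t => ?_
  obtain ⟨x, rfl⟩ := φ.surjective t
  have hpre : φ ⁻¹' Iic (φ x) = Iic x := by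
    ext y
    simp [hφm.le_iff_le]
  rw [Measure.map_apply φ.measurable measurableSet_Iic, hpre, unitInterval.volume_Iic, hφF]
  change _ = ENNReal.ofReal (ProbabilityTheory.cdf ρ x)
  rw [hcdf, ofReal_measureReal]

/-! ### Left parts -/

/-- The points to the left of `K`. -/
def leftPart (K : Set I) : Set I := {x | ∀ b ∈ K, x < b}

theorem disjoint_leftPart (K : Set I) : Disjoint (leftPart K) K :=
  disjoint_left.2 fun x hx hxK => lt_irrefl x (hx x hxK)

/-- The total mass of the members of a partition to the left of `K` is the mass of `leftPart K`. -/
theorem tsum_measureReal_left {ι : Type*} [Countable ι] {ν : Measure I} [IsProbabilityMeasure ν]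
    {E : ι → Set I} (hE : ∀ a, OrdConnected (E a)) (hd : Pairwise (Function.onFun Disjoint E))
    (hnull : ν (⋃ a, E a)ᶜ = 0) {K : Set I} (hK : ∀ a, (E a ∩ K).Nonempty → E a ⊆ K) {W : Set ι}
    (hW : ∀ a, a ∈ W ↔ (E a).Nonempty ∧ LiesLeftOf (E a) K) :
    ∑' a : W, ν.real (E a) = ν.real (leftPart K) := by
  have hsub1 : (⋃ a : W, E a) ⊆ leftPart K :=
    iUnion_subset fun a x hx b hb => ((hW a).1 a.2).2 x hx b hb
  have hsub2 : leftPart K ⊆ (⋃ a : W, E a) ∪ (⋃ a, E a)ᶜ := by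
    intro x hx
    by_cases h : x ∈ ⋃ a, E a
    · obtain ⟨a, ha⟩ := mem_iUnion.1 h
      refine Or.inl (mem_iUnion.2 ⟨⟨a, (hW a).2 ⟨⟨x, ha⟩, fun y hy b hb => ?_⟩⟩, ha⟩)
      -- Otherwise the convex set `E a` would contain `b`, hence lie in `K`, and with it `x`.
      by_contra hcon
      have hbE : b ∈ E a := (hE a).out ha hy ⟨(hx b hb).le, not_lt.1 hcon⟩
      exact lt_irrefl x (hx x (hK a ⟨b, hbE, hb⟩ ha))
    · exact Or.inr h
  have heq : ν (leftPart K) = ν (⋃ a : W, E a) := by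
    refine le_antisymm ?_ (measure_mono hsub1)
    refine (measure_mono hsub2).trans ((measure_union_le _ _).trans ?_)
    rw [hnull, add_zero]
  rw [measureReal_def, heq, measure_iUnion (f := fun a : W => E a)
    (fun a b hab => hd fun h => hab (Subtype.ext h)) fun a => (hE a).measurableSet,
    ENNReal.tsum_toReal_eq fun a => measure_ne_top _ _]
  rfl

theorem measureReal_Iio_of_mem {ν : Measure I} [IsProbabilityMeasure ν] {K : Set I}
    (hK : OrdConnected K) {x : I} (hx : x ∈ K) :
    ν.real (Iio x) = ν.real (leftPart K) + ν.real (K ∩ Iio x) := by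
  have : Iio x = leftPart K ∪ (K ∩ Iio x) := by
    ext y
    constructor
    · intro hy
      by_cases hyK : y ∈ K
      · exact Or.inr ⟨hyK, hy⟩
      · refine Or.inl fun b hb => ?_
        by_contra hcon
        exact hyK (hK.out hb hx ⟨not_lt.1 hcon, le_of_lt hy⟩)
    · rintro (hy | hy)
      · exact hy x hx
      · exact hy.2
  conv_lhs => rw [this]
  exact measureReal_union ((disjoint_leftPart K).mono_right inter_subset_left)
    (hK.measurableSet.inter measurableSet_Iio)

theorem measureReal_Iic_eq_Iio {ν : Measure I} [IsProbabilityMeasure ν] (hν : ∀ c, ν {c} = 0)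
    (x : I) : ν.real (Iic x) = ν.real (Iio x) := by
  rw [← Iio_union_right, measureReal_union (by simp) (measurableSet_singleton x)]
  rw [measureReal_def (s := {x}), hν, ENNReal.toReal_zero, add_zero]

/-! ### The affine pieces -/

theorem image_affine_Ioo_of_pos {s d x x' : ℝ} (hs : 0 < s) :
    (fun t : ℝ => s * t + d) '' Ioo x x' = Ioo (s * x + d) (s * x' + d) := by
  have : (fun t : ℝ => s * t + d) = (fun t => t + d) ∘ fun t => s * t := rfl
  rw [this, image_comp, image_mul_left_Ioo hs, image_add_const_Ioo]

theorem image_affine_Ioo_of_neg {s d x x' : ℝ} (hs : s < 0) :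
    (fun t : ℝ => s * t + d) '' Ioo x x' = Ioo (s * x' + d) (s * x + d) := by
  have : (fun t : ℝ => s * t + d) = (fun t => (-s) * t + d) ∘ fun t => -t := by
    funext t
    simp
  rw [this, image_comp, image_neg_Ioo, image_affine_Ioo_of_pos (by linarith)]
  congr 1 <;> ring

theorem Ioo_eq_Ioo_of_lt {a b c d : ℝ} (hab : a < b) (hcd : c < d) (h : Ioo a b = Ioo c d) :
    a = c ∧ b = d := by
  constructor
  · rw [← csInf_Ioo hab, h, csInf_Ioo hcd]
  · rw [← csSup_Ioo hab, h, csSup_Ioo hcd]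

/-- An affine map of given orientation is determined by its values at the two ends, which the image
interval reveals. -/
theorem MapsAffinelyOnto.congr_of_pos {g g' : I → I} {s d s' d' x x' y y' : ℝ}
    (h : MapsAffinelyOnto g s d x x' y y') (h' : MapsAffinelyOnto g' s' d' x x' y y')
    (hs : 0 < s) (hs' : 0 < s') (hx : x < x') : ∀ t : I, (t : ℝ) ∈ Ioo x x' → g t = g' t := by
  intro t ht
  obtain ⟨_, h1⟩ := h.1 t ht
  obtain ⟨_, h2⟩ := h'.1 t ht
  have e1 := h.2
  have e2 := h'.2
  rw [image_affine_Ioo_of_pos hs] at e1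
  rw [image_affine_Ioo_of_pos hs', ← e1] at e2
  replace e2 := Ioo_eq_Ioo_of_lt (by nlinarith) (by nlinarith) e2
  have e3 : (s - s') * (x' - x) = 0 := by linarith [e2.1, e2.2]
  have e4 : s = s' := by
    rcases mul_eq_zero.1 e3 with h | h <;> linarith
  subst e4
  refine Subtype.ext ?_
  have := e2.1
  rw [h1, h2]
  linarith

theorem MapsAffinelyOnto.congr_of_neg {g g' : I → I} {s d s' d' x x' y y' : ℝ}
    (h : MapsAffinelyOnto g s d x x' y y') (h' : MapsAffinelyOnto g' s' d' x x' y y')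
    (hs : s < 0) (hs' : s' < 0) (hx : x < x') : ∀ t : I, (t : ℝ) ∈ Ioo x x' → g t = g' t := by
  intro t ht
  obtain ⟨_, h1⟩ := h.1 t ht
  obtain ⟨_, h2⟩ := h'.1 t ht
  have e1 := h.2
  have e2 := h'.2
  rw [image_affine_Ioo_of_neg hs] at e1
  rw [image_affine_Ioo_of_neg hs', ← e1] at e2
  replace e2 := Ioo_eq_Ioo_of_lt (by nlinarith) (by nlinarith) e2
  have e3 : (s - s') * (x' - x) = 0 := by linarith [e2.1, e2.2]
  have e4 : s = s' := by
    rcases mul_eq_zero.1 e3 with h | h <;> linarith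
  subst e4
  refine Subtype.ext ?_
  have := e2.1
  rw [h1, h2]
  linarith

/-- The measures on `[0,1]` whose distribution function straightens `f`. -/
structure IsAdaptedMeasure (f : I → I) (𝒳 : Set (Set I)) (π : partitionIntervals 𝒳 → ℝ)
    (P : Matrix (partitionIntervals 𝒳) (partitionIntervals 𝒳) ℝ) (ν : Measure I) : Prop where
  isProbabilityMeasure : IsProbabilityMeasure ν
  measure_singleton : ∀ c, ν {c} = 0
  measure_pos : ∀ U : Set I, IsOpen U → U.Nonempty → 0 < ν U
  measureReal_interval : ∀ i : partitionIntervals 𝒳, ν.real i = π i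
  measureReal_piece : ∀ i j : partitionIntervals 𝒳, transitionMatrix f 𝒳 i j = 1 →
    ν.real ((i : Set I) ∩ f ⁻¹' j) = π i * P i j
  measureReal_image : ∀ i j : partitionIntervals 𝒳, transitionMatrix f 𝒳 i j = 1 →
    ∀ B, MeasurableSet B → B ⊆ (j : Set I) →
      ν.real B = (predCount (transitionMatrix f 𝒳) j).toNat * ν.real ((i : Set I) ∩ f ⁻¹' B)

/-! ### The combinatorial sums as masses of left parts. -/

namespace IsCountablyMarkovMixing

variable {f : I → I} {𝒳 : Set (Set I)} {π : partitionIntervals 𝒳 → ℝ}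
  {P : Matrix (partitionIntervals 𝒳) (partitionIntervals 𝒳) ℝ} {ν : Measure I}

theorem isAdaptedMeasure_map_codedPoint (hf : IsCountablyMarkovMixing f 𝒳)
    {μ : Measure (MarkovShift (transitionMatrix f 𝒳))} (hμ : IsMarkovMeasure π P μ)
    (hfair : IsFair (shiftMap (transitionMatrix f 𝒳)) μ) :
    IsAdaptedMeasure f 𝒳 π P (μ.map hf.codedPoint) := by
  have := hf.countable_intervals
  have hfν := hf.isFair_map_codedPoint hμ hfair
  obtain ⟨hpos, hc, hrel⟩ := hμ.fair_relation hfair hf.reflTransGen_transition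
  have hint : ∀ i : partitionIntervals 𝒳, (μ.map hf.codedPoint).real i = π i := fun i => by
    rw [measureReal_def, hf.map_codedPoint_interval hμ hfair, ENNReal.toReal_ofReal (hpos i).le]
  have himg : ∀ i j : partitionIntervals 𝒳, transitionMatrix f 𝒳 i j = 1 →
      ∀ B, MeasurableSet B → B ⊆ (j : Set I) → (μ.map hf.codedPoint).real B =
        (predCount (transitionMatrix f 𝒳) j).toNat *
          (μ.map hf.codedPoint).real ((i : Set I) ∩ f ⁻¹' B) := by
    intro i j hij B hB hBj
    have hn : ((predCount (transitionMatrix f 𝒳) j).toNat : ℕ∞) =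
      predCount (transitionMatrix f 𝒳) j := ENat.natCast_toNat (hc j).2
    have hn0 : (predCount (transitionMatrix f 𝒳) j).toNat ≠ 0 := fun h0 =>
      (hc j).1 (by rw [← hn, h0]; rfl)
    rw [measureReal_def, measureReal_def, hf.fair_local hfν hij hB hBj, ← hn]
    simp only [ENat.toENNReal_coe, ENNReal.toReal_div, ENNReal.toReal_natCast, ENat.toNat_natCast]
    rw [mul_div_cancel₀]
    exact_mod_cast hn0
  refine ⟨hfν.1, hf.map_codedPoint_singleton hμ hfair,
    fun U hU hne => hf.map_codedPoint_pos hμ hfair hU hne, hint, fun i j hij => ?_, himg⟩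
  have h1 := himg i j hij j (hf.measurableSet_interval j) subset_rfl
  rw [hint, ← (hrel i j hij).2, mul_comm] at h1
  refine (mul_left_cancel₀ (fun h0 => ?_) h1).symm
  have := (hrel i j hij).2
  rw [h0, mul_zero] at this
  exact (hpos j).ne this

theorem nonempty_piece_iff (hf : IsCountablyMarkovMixing f 𝒳) {i j : partitionIntervals 𝒳} :
    ((i : Set I) ∩ f ⁻¹' j).Nonempty ↔ transitionMatrix f 𝒳 i j = 1 := by
  refine ⟨fun ⟨x, hx⟩ => hf.transition_of_mem hx.1 hx.2, fun h => ?_⟩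
  obtain ⟨y, hy⟩ := hf.nonempty j.2.1
  obtain ⟨x, hx, rfl⟩ := transitionMatrix_eq_one_iff.1 h hy
  exact ⟨x, hx, hy⟩

theorem isOpen_piece (hf : IsCountablyMarkovMixing f 𝒳) (i j : partitionIntervals 𝒳) :
    IsOpen ((i : Set I) ∩ f ⁻¹' j) :=
  (hf.continuousOn _ i.2).isOpen_inter_preimage (isOpen_of_mem_partitionIntervals i)
    (isOpen_of_mem_partitionIntervals j)

theorem ordConnected_piece (hf : IsCountablyMarkovMixing f 𝒳) {i j : Set I} (hi : i ∈ 𝒳)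
    (hj : j ∈ 𝒳) : OrdConnected (i ∩ f ⁻¹' j) := by
  rcases hf.interval_or_point i hi with h | ⟨x, rfl⟩
  · exact (hf.ordConnected hi).inter_preimage_of_monotone_or_antitone (hf.ordConnected hj)
      (hf.strictMonotone i ⟨hi, h⟩)
  · refine ⟨fun y hy z hz w hw => ?_⟩
    obtain rfl : y = z := hy.1.trans hz.1.symm
    rwa [le_antisymm hw.2 hw.1]

theorem measure_countable (hν : IsAdaptedMeasure f 𝒳 π P ν) {s : Set I} (hs : s.Countable) :
    ν s = 0 := by
  rw [← biUnion_of_singleton s]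
  exact (measure_biUnion_null_iff hs).2 fun c _ => hν.measure_singleton c

theorem cellStart_eq (hf : IsCountablyMarkovMixing f 𝒳) (hν : IsAdaptedMeasure f 𝒳 π P ν)
    {j : Set I} (hj : j ∈ 𝒳) : cellStart 𝒳 π j = ν.real (leftPart j) := by
  have := hf.countable_intervals
  have := hν.isProbabilityMeasure
  rw [← tsum_measureReal_left (E := fun l : partitionIntervals 𝒳 => (l : Set I))
    (W := leftIntervals 𝒳 j) ordConnected_of_mem_partitionIntervals
    (fun k l hkl => disjoint_left.2 fun x hx hx' => hkl (hf.interval_eq_of_mem hx hx')) ?_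
    (fun l ⟨x, hx, hx'⟩ => (hf.eq_of_mem l.2.1 hj hx hx').subset)
    fun l => ⟨fun h => ⟨hf.nonempty l.2.1, h⟩, fun h => h.2⟩]
  · exact tsum_congr fun l => (hν.measureReal_interval l).symm
  · refine measure_countable hν (hf.countable_points.mono fun x hx => ?_)
    by_contra h
    exact hx (mem_iUnion.2 (hf.exists_interval h))

/-- The pieces over intervals cover `[0,1]` up to the points that are singletons of the partition or
map to one, a countable set. -/
theorem pieceStart_eq (hf : IsCountablyMarkovMixing f 𝒳) (hν : IsAdaptedMeasure f 𝒳 π P ν)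
    {i j : Set I} (hi : i ∈ 𝒳) (hj : j ∈ 𝒳) :
    pieceStart f 𝒳 π P i j = ν.real (leftPart (i ∩ f ⁻¹' j)) := by
  have := hf.countable_intervals
  have := hν.isProbabilityMeasure
  rw [← tsum_measureReal_left
    (E := fun kl : partitionIntervals 𝒳 × partitionIntervals 𝒳 => (kl.1 : Set I) ∩ f ⁻¹' kl.2)
    (W := leftPieces f 𝒳 i j) (fun kl => hf.ordConnected_piece kl.1.2.1 kl.2.2.1)
    (fun kl kl' hne => disjoint_left.2 fun x hx hx' => hne
      (Prod.ext (hf.interval_eq_of_mem hx.1 hx'.1) (hf.interval_eq_of_mem hx.2 hx'.2))) ?_ ?_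
    fun kl => Iff.rfl]
  · exact tsum_congr fun kl =>
      (hν.measureReal_piece _ _ (hf.nonempty_piece_iff.1 kl.2.1)).symm
  · refine measure_countable hν ((hf.countable_points.union
      (hf.countable_preimage hf.countable_points)).mono fun x hx => ?_)
    by_contra h
    rw [mem_union, not_or] at h
    obtain ⟨k, hk⟩ := hf.exists_interval h.1
    obtain ⟨l, hl⟩ := hf.exists_interval h.2
    exact hx (mem_iUnion.2 ⟨(k, l), hk, hl⟩)
  · rintro ⟨k, l⟩ ⟨x, ⟨hxk, hxl⟩, hxi, hxj⟩
    rw [hf.eq_of_mem k.2.1 hi hxk hxi, hf.eq_of_mem l.2.1 hj hxl hxj]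

end IsCountablyMarkovMixing

theorem coe_eq_measureReal_Iio {ν : Measure I} [IsProbabilityMeasure ν] (hν : ∀ c, ν {c} = 0)
    {φ : I ≃ₜ I} (hφ : StrictMono φ) (hmap : ν.map φ = volume) (x : I) :
    (φ x : ℝ) = ν.real (Iio x) := by
  rw [coe_eq_measureReal_Iic hφ hmap, measureReal_Iic_eq_Iio hν]

/-- The image under the distribution function of an interval without end points. -/
theorem coe_mem_Ioo_iff {ν : Measure I} [IsProbabilityMeasure ν] (hν : ∀ c, ν {c} = 0)
    (hpos : ∀ U : Set I, IsOpen U → U.Nonempty → 0 < ν U) {φ : I ≃ₜ I} (hφ : StrictMono φ)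
    (hmap : ν.map φ = volume) {K : Set I} (hKo : IsOpen K) (hKc : OrdConnected K)
    (hlt : ∀ x ∈ K, ∃ y ∈ K, y < x) (hgt : ∀ x ∈ K, ∃ y ∈ K, x < y) {x : I} :
    (φ x : ℝ) ∈ Ioo (ν.real (leftPart K)) (ν.real (leftPart K) + ν.real K) ↔ x ∈ K := by
  constructor
  · intro h
    by_contra hx
    by_cases hall : ∀ b ∈ K, x < b
    · have h1 : ν.real (Iio x) ≤ ν.real (leftPart K) :=
        measureReal_mono fun y (hy : y < x) b hb => hy.trans (hall b hb)
      rw [← coe_eq_measureReal_Iio hν hφ hmap] at h1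
      exact absurd h.1 (not_lt.2 h1)
    · push Not at hall
      obtain ⟨b, hb, hbx⟩ := hall
      have hsub : leftPart K ∪ K ⊆ Iic x := by
        rintro y (hy | hy)
        · exact (hy b hb).le.trans hbx
        · by_contra hcon
          exact hx (hKc.out hb hy ⟨hbx, (not_le.1 hcon).le⟩)
      have h1 := measureReal_mono (μ := ν) hsub
      rw [measureReal_union (disjoint_leftPart K) hKc.measurableSet,
        ← coe_eq_measureReal_Iic hφ hmap] at h1
      exact absurd h.2 (not_lt.2 h1)
  · intro hx
    have h1 := measureReal_Iio_of_mem (ν := ν) hKc hx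
    rw [← coe_eq_measureReal_Iio hν hφ hmap] at h1
    have h2 : 0 < ν.real (K ∩ Iio x) := by
      obtain ⟨y, hy, hyx⟩ := hlt x hx
      exact ENNReal.toReal_pos (hpos _ (hKo.inter isOpen_Iio) ⟨y, hy, hyx⟩).ne'
        (measure_ne_top _ _)
    have h3 : 0 < ν.real (K ∩ Ioi x) := by
      obtain ⟨y, hy, hyx⟩ := hgt x hx
      exact ENNReal.toReal_pos (hpos _ (hKo.inter isOpen_Ioi) ⟨y, hy, hyx⟩).ne'
        (measure_ne_top _ _)
    have h4 : ν.real (K ∩ Iio x) + ν.real (K ∩ Ioi x) ≤ ν.real K := by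
      rw [← measureReal_union (disjoint_left.2 fun y hy hy' => lt_asymm (mem_Iio.1 hy.2) hy'.2)
        (hKc.measurableSet.inter measurableSet_Ioi)]
      exact measureReal_mono (union_subset inter_subset_left inter_subset_left)
    constructor <;> linarith

/-! ### The conjugate of the map by the distribution function. -/

namespace IsCountablyMarkovMixing

variable {f : I → I} {𝒳 : Set (Set I)} {π : partitionIntervals 𝒳 → ℝ}
  {P : Matrix (partitionIntervals 𝒳) (partitionIntervals 𝒳) ℝ} {ν : Measure I} {φ : I ≃ₜ I}

theorem exists_lt_mem_piece (hf : IsCountablyMarkovMixing f 𝒳) (i j : partitionIntervals 𝒳)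
    {x : I} (hx : x ∈ (i : Set I) ∩ f ⁻¹' j) : ∃ y ∈ (i : Set I) ∩ f ⁻¹' j, y < x := by
  obtain ⟨a, b, hab⟩ := i.2.2
  have hax : a < x := by
    have := hx.1
    rw [hab] at this
    exact this.1
  -- The point `a` below `x` excludes the end point 0, where this closure would be empty.
  have hcl : x ∈ closure (Iio x) := by
    rw [closure_Iio' ⟨a, hax⟩]
    exact mem_Iic.2 le_rfl
  obtain ⟨y, hy, hyx⟩ := mem_closure_iff.1 hcl _ (hf.isOpen_piece i j) hx
  exact ⟨y, hy, hyx⟩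

theorem exists_gt_mem_piece (hf : IsCountablyMarkovMixing f 𝒳) (i j : partitionIntervals 𝒳)
    {x : I} (hx : x ∈ (i : Set I) ∩ f ⁻¹' j) : ∃ y ∈ (i : Set I) ∩ f ⁻¹' j, x < y := by
  obtain ⟨a, b, hab⟩ := i.2.2
  have hax : x < b := by
    have := hx.1
    rw [hab] at this
    exact this.2
  have hcl : x ∈ closure (Ioi x) := by
    rw [closure_Ioi' ⟨b, hax⟩]
    exact mem_Ici.2 le_rfl
  obtain ⟨y, hy, hyx⟩ := mem_closure_iff.1 hcl _ (hf.isOpen_piece i j) hx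
  exact ⟨y, hy, hyx⟩

theorem coe_mem_piece_iff (hf : IsCountablyMarkovMixing f 𝒳) (hν : IsAdaptedMeasure f 𝒳 π P ν)
    (hφ : StrictMono φ) (hmap : ν.map φ = volume) {i j : partitionIntervals 𝒳}
    (hij : transitionMatrix f 𝒳 i j = 1) {x : I} :
    (φ x : ℝ) ∈ Ioo (pieceStart f 𝒳 π P i j) (pieceStart f 𝒳 π P i j + π i * P i j) ↔
      x ∈ (i : Set I) ∩ f ⁻¹' j := by
  have := hν.isProbabilityMeasure
  rw [hf.pieceStart_eq hν i.2.1 j.2.1, ← hν.measureReal_piece i j hij]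
  exact coe_mem_Ioo_iff hν.measure_singleton hν.measure_pos hφ hmap (hf.isOpen_piece i j)
    (hf.ordConnected_piece i.2.1 j.2.1) (fun _ => hf.exists_lt_mem_piece i j)
    fun _ => hf.exists_gt_mem_piece i j

theorem piece_subset_unitInterval (hf : IsCountablyMarkovMixing f 𝒳)
    (hν : IsAdaptedMeasure f 𝒳 π P ν) {i j : partitionIntervals 𝒳}
    (hij : transitionMatrix f 𝒳 i j = 1) :
    Ioo (pieceStart f 𝒳 π P i j) (pieceStart f 𝒳 π P i j + π i * P i j) ⊆ unitInterval := by
  have := hν.isProbabilityMeasure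
  rw [hf.pieceStart_eq hν i.2.1 j.2.1, ← hν.measureReal_piece i j hij,
    ← measureReal_union (disjoint_leftPart _) (hf.isOpen_piece i j).measurableSet]
  exact fun t ht => ⟨measureReal_nonneg.trans ht.1.le, ht.2.le.trans measureReal_le_one⟩

/-- `φ (f x)` is the mass to the left of `j` plus the mass of `j` below `f x`. The latter is `c_j`
times the mass of the piece left of `x`, because `f` preserves order on `i`; this is affine in `φ
x`. -/
theorem coe_apply_of_strictMonoOn (hf : IsCountablyMarkovMixing f 𝒳)
    (hν : IsAdaptedMeasure f 𝒳 π P ν) (hφ : StrictMono φ) (hmap : ν.map φ = volume)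
    {i j : partitionIntervals 𝒳} (hmono : StrictMonoOn f (i : Set I)) {x : I}
    (hx : x ∈ (i : Set I) ∩ f ⁻¹' j) :
    (φ (f x) : ℝ) = (predCount (transitionMatrix f 𝒳) j).toNat * φ x +
      (cellStart 𝒳 π j -
        (predCount (transitionMatrix f 𝒳) j).toNat * pieceStart f 𝒳 π P i j) := by
  have := hν.isProbabilityMeasure
  have hij := hf.transition_of_mem hx.1 hx.2
  have hset : (i : Set I) ∩ f ⁻¹' ((j : Set I) ∩ Iio (f x)) =
      ((i : Set I) ∩ f ⁻¹' j) ∩ Iio x := by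
    ext y
    simp only [mem_inter_iff, mem_preimage, mem_Iio, and_assoc]
    refine and_congr_right fun hy => and_congr_right fun _ => ?_
    exact hmono.lt_iff_lt hy hx.1
  rw [coe_eq_measureReal_Iio hν.measure_singleton hφ hmap,
    measureReal_Iio_of_mem (hf.ordConnected j.2.1) hx.2,
    hν.measureReal_image i j hij _ ((hf.measurableSet_interval j).inter measurableSet_Iio)
      inter_subset_left, hset, coe_eq_measureReal_Iio hν.measure_singleton hφ hmap,
    measureReal_Iio_of_mem (hf.ordConnected_piece i.2.1 j.2.1) hx, hf.cellStart_eq hν j.2.1,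
    hf.pieceStart_eq hν i.2.1 j.2.1]
  ring

/-- Here the part of `j` below `f x` comes from the part of the piece to the right of `x`, whose
mass is the total minus the left part. -/
theorem coe_apply_of_strictAntiOn (hf : IsCountablyMarkovMixing f 𝒳)
    (hν : IsAdaptedMeasure f 𝒳 π P ν) (hφ : StrictMono φ) (hmap : ν.map φ = volume)
    {i j : partitionIntervals 𝒳} (hanti : StrictAntiOn f (i : Set I)) {x : I}
    (hx : x ∈ (i : Set I) ∩ f ⁻¹' j) :
    (φ (f x) : ℝ) = -(predCount (transitionMatrix f 𝒳) j).toNat * φ x +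
      (cellStart 𝒳 π j + π j +
        (predCount (transitionMatrix f 𝒳) j).toNat * pieceStart f 𝒳 π P i j) := by
  have := hν.isProbabilityMeasure
  have hij := hf.transition_of_mem hx.1 hx.2
  have hset : (i : Set I) ∩ f ⁻¹' ((j : Set I) ∩ Iio (f x)) =
      ((i : Set I) ∩ f ⁻¹' j) ∩ Ioi x := by
    ext y
    simp only [mem_inter_iff, mem_preimage, mem_Iio, mem_Ioi, and_assoc]
    refine and_congr_right fun hy => and_congr_right fun _ => ?_
    exact hanti.lt_iff_gt hy hx.1
  have hK := (hf.isOpen_piece i j).measurableSet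
  have hsplit : ν.real ((i : Set I) ∩ f ⁻¹' j) =
      ν.real (((i : Set I) ∩ f ⁻¹' j) ∩ Iio x) + ν.real (((i : Set I) ∩ f ⁻¹' j) ∩ Ioi x) := by
    rw [← measureReal_union (disjoint_left.2 fun y hy hy' => lt_asymm (mem_Iio.1 hy.2) hy'.2)
      (hK.inter measurableSet_Ioi), ← inter_union_distrib_left, Iio_union_Ioi]
    have hx0 : ν.real {x} = 0 := by
      rw [measureReal_def, hν.measure_singleton, ENNReal.toReal_zero]
    rw [← sdiff_eq]
    refine le_antisymm ?_ (measureReal_mono sdiff_subset)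
    have := measureReal_union_le (μ := ν) (((i : Set I) ∩ f ⁻¹' j) \ {x}) {x}
    rw [hx0, add_zero] at this
    refine le_trans (measureReal_mono ?_) this
    rw [sdiff_union_self]
    exact subset_union_left
  have hj := hν.measureReal_image i j hij j (hf.measurableSet_interval j) subset_rfl
  rw [hν.measureReal_interval, hsplit] at hj
  rw [coe_eq_measureReal_Iio hν.measure_singleton hφ hmap,
    measureReal_Iio_of_mem (hf.ordConnected j.2.1) hx.2,
    hν.measureReal_image i j hij _ ((hf.measurableSet_interval j).inter measurableSet_Iio)
      inter_subset_left, hset, coe_eq_measureReal_Iio hν.measure_singleton hφ hmap,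
    measureReal_Iio_of_mem (hf.ordConnected_piece i.2.1 j.2.1) hx, hf.cellStart_eq hν j.2.1,
    hf.pieceStart_eq hν i.2.1 j.2.1, hj]
  ring

theorem not_strictMonoOn_and_strictAntiOn (hf : IsCountablyMarkovMixing f 𝒳)
    (i : partitionIntervals 𝒳) (h : StrictMonoOn f (i : Set I)) (h' : StrictAntiOn f (i : Set I)) :
    False := by
  obtain ⟨x, hx⟩ := hf.nonempty i.2.1
  obtain ⟨y, hy, hyx⟩ :=
    (countable_singleton x).exists_mem_not_mem_of_isOpen (isOpen_of_mem_partitionIntervals i)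
      ⟨x, hx⟩
  rcases lt_or_gt_of_ne (show y ≠ x from hyx) with hlt | hlt
  · exact lt_asymm (h hy hx hlt) (h' hy hx hlt)
  · exact lt_asymm (h hx hy hlt) (h' hx hy hlt)

/-- The conjugate of `f` by the distribution function is affine on the pieces. -/
theorem exists_mapsAffinelyOnto (hf : IsCountablyMarkovMixing f 𝒳)
    (hν : IsAdaptedMeasure f 𝒳 π P ν) (hφ : StrictMono φ) (hmap : ν.map φ = volume) {g : I → I}
    (hg : ∀ x, g (φ x) = φ (f x)) {i j : partitionIntervals 𝒳}
    (hc : predCount (transitionMatrix f 𝒳) j ≠ 0 ∧ predCount (transitionMatrix f 𝒳) j ≠ ⊤)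
    (hij : transitionMatrix f 𝒳 i j = 1) :
    ∃ d : ℝ,
      (StrictMonoOn f (i : Set I) ∧
        MapsAffinelyOnto g (predCount (transitionMatrix f 𝒳) j).toNat d
          (pieceStart f 𝒳 π P i j) (pieceStart f 𝒳 π P i j + π i * P i j)
          (cellStart 𝒳 π j) (cellStart 𝒳 π j + π j)) ∨
      (StrictAntiOn f (i : Set I) ∧
        MapsAffinelyOnto g (-(predCount (transitionMatrix f 𝒳) j).toNat) d
          (pieceStart f 𝒳 π P i j) (pieceStart f 𝒳 π P i j + π i * P i j)
          (cellStart 𝒳 π j) (cellStart 𝒳 π j + π j)) := by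
  have hc0 : (0 : ℝ) < (predCount (transitionMatrix f 𝒳) j).toNat := by
    rw [Nat.cast_pos, Nat.pos_iff_ne_zero, ne_eq, ENat.toNat_eq_zero, not_or]
    exact hc
  have hπ : π j = (predCount (transitionMatrix f 𝒳) j).toNat * (π i * P i j) := by
    rw [← hν.measureReal_piece i j hij, ← hν.measureReal_interval j]
    exact hν.measureReal_image i j hij j (hf.measurableSet_interval j) subset_rfl
  have hpt : ∀ t ∈ Ioo (pieceStart f 𝒳 π P i j) (pieceStart f 𝒳 π P i j + π i * P i j),
      ∃ ht : t ∈ unitInterval, ∃ x ∈ (i : Set I) ∩ f ⁻¹' j, φ x = ⟨t, ht⟩ := by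
    intro t ht
    have htI := hf.piece_subset_unitInterval hν hij ht
    obtain ⟨x, hx⟩ := φ.surjective ⟨t, htI⟩
    refine ⟨htI, x, (hf.coe_mem_piece_iff hν hφ hmap hij).1 ?_, hx⟩
    rwa [hx]
  rcases hf.strictMonotone i i.2 with hmono | hanti
  · refine ⟨cellStart 𝒳 π j -
        (predCount (transitionMatrix f 𝒳) j).toNat * pieceStart f 𝒳 π P i j,
        Or.inl ⟨hmono, fun t ht => ?_, ?_⟩⟩
    · obtain ⟨htI, x, hx, hxt⟩ := hpt t ht
      refine ⟨htI, ?_⟩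
      rw [← hxt, hg, hf.coe_apply_of_strictMonoOn hν hφ hmap hmono hx, hxt]
    · rw [image_affine_Ioo_of_pos hc0]
      congr 1
      · ring
      · rw [hπ]
        ring
  · refine ⟨cellStart 𝒳 π j + π j +
        (predCount (transitionMatrix f 𝒳) j).toNat * pieceStart f 𝒳 π P i j,
        Or.inr ⟨hanti, fun t ht => ?_, ?_⟩⟩
    · obtain ⟨htI, x, hx, hxt⟩ := hpt t ht
      refine ⟨htI, ?_⟩
      rw [← hxt, hg, hf.coe_apply_of_strictAntiOn hν hφ hmap hanti hx, hxt]
    · rw [image_affine_Ioo_of_neg (neg_lt_zero.2 hc0)]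
      congr 1
      · rw [hπ]
        ring
      · ring

theorem isPiecewiseAffineModel (hf : IsCountablyMarkovMixing f 𝒳)
    (hν : IsAdaptedMeasure f 𝒳 π P ν) (hφ : StrictMono φ) (hmap : ν.map φ = volume) {g : I → I}
    (hg : ∀ x, g (φ x) = φ (f x))
    (hc : ∀ j, predCount (transitionMatrix f 𝒳) j ≠ 0 ∧ predCount (transitionMatrix f 𝒳) j ≠ ⊤) :
    IsPiecewiseAffineModel f 𝒳 π P g := by
  have := hν.isProbabilityMeasure
  constructor
  · intro i j hij
    have hc0 : (0 : ℝ) < (predCount (transitionMatrix f 𝒳) j).toNat := by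
      rw [Nat.cast_pos, Nat.pos_iff_ne_zero, ne_eq, ENat.toNat_eq_zero, not_or]
      exact hc j
    obtain ⟨d, ⟨hm, h⟩ | ⟨hm, h⟩⟩ :=
      hf.exists_mapsAffinelyOnto hν hφ hmap hg (hc j) (hf.nonempty_piece_iff.1 hij)
    · exact ⟨_, d, h, fun _ => hc0, fun h' =>
        (hf.not_strictMonoOn_and_strictAntiOn i hm h').elim⟩
    · exact ⟨_, d, h, fun h' => (hf.not_strictMonoOn_and_strictAntiOn i h' hm).elim,
        fun _ => neg_lt_zero.2 hc0⟩
  · rintro i hi c hc ⟨x, hxi, rfl⟩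
    -- Injectivity on the cell reduces the piece over a singleton to one point, so its start is `φ
    -- x`.
    have hK : i ∩ f ⁻¹' {f x} = {x} := by
      ext y
      constructor
      · rintro ⟨hy, hyx⟩
        exact hf.injOn hi hy hxi hyx
      · rintro rfl
        exact ⟨hxi, rfl⟩
    have hleft : ∀ y : I, leftPart {y} = Iio y := fun y => by
      ext z; simp [leftPart]
    refine ⟨φ x, ?_, ?_⟩
    · rw [hf.pieceStart_eq hν hi hc, hK, hleft, coe_eq_measureReal_Iio hν.measure_singleton hφ hmap]
    · rw [hg, hf.cellStart_eq hν hc, hleft, coe_eq_measureReal_Iio hν.measure_singleton hφ hmap]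

theorem eq_of_isPiecewiseAffineModel (hf : IsCountablyMarkovMixing f 𝒳)
    (hν : IsAdaptedMeasure f 𝒳 π P ν) (hφ : StrictMono φ) (hmap : ν.map φ = volume)
    {g g' : I → I} (h : IsPiecewiseAffineModel f 𝒳 π P g)
    (h' : IsPiecewiseAffineModel f 𝒳 π P g') : g = g' := by
  have := hν.isProbabilityMeasure
  funext t
  obtain ⟨x, rfl⟩ := φ.surjective t
  obtain ⟨i, ⟨hi, hxi⟩, -⟩ := hf.isPartition.2 x
  -- The image decides which clause applies: if `f x` is not a singleton of the partition, neither
  -- is `x`, by invariance, and `x` lies in an open piece.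
  by_cases hfx : {f x} ∈ 𝒳
  · obtain ⟨t, ht, hgt⟩ := h.on_points i hi _ hfx ⟨x, hxi, rfl⟩
    obtain ⟨t', ht', hgt'⟩ := h'.on_points i hi _ hfx ⟨x, hxi, rfl⟩
    have hK : i ∩ f ⁻¹' {f x} = {x} := by
      ext y
      constructor
      · rintro ⟨hy, hyx⟩
        exact hf.injOn hi hy hxi hyx
      · rintro rfl
        exact ⟨hxi, rfl⟩
    have hleft : leftPart {x} = Iio x := by
      ext z; simp [leftPart]
    have hstart : pieceStart f 𝒳 π P i {f x} = φ x := by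
      rw [hf.pieceStart_eq hν hi hfx, hK, hleft,
        coe_eq_measureReal_Iio hν.measure_singleton hφ hmap]
    obtain rfl : t = φ x := Subtype.ext (ht.trans hstart)
    obtain rfl : t' = φ x := Subtype.ext (ht'.trans hstart)
    exact Subtype.ext (hgt.trans hgt'.symm)
  · obtain ⟨j, hj⟩ := hf.exists_interval hfx
    obtain ⟨i, hi⟩ := hf.exists_interval (x := x) fun hx => hfx (hf.points_invariant x hx)
    obtain ⟨s, d, hm, hp, hn⟩ := h.on_intervals i j ⟨x, hi, hj⟩
    obtain ⟨s', d', hm', hp', hn'⟩ := h'.on_intervals i j ⟨x, hi, hj⟩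
    have hmem := (hf.coe_mem_piece_iff hν hφ hmap (hf.transition_of_mem hi hj)).2 ⟨hi, hj⟩
    rcases hf.strictMonotone i i.2 with hmono | hanti
    · exact hm.congr_of_pos hm' (hp hmono) (hp' hmono) (hmem.1.trans hmem.2) _ hmem
    · exact hm.congr_of_neg hm' (hn hanti) (hn' hanti) (hmem.1.trans hmem.2) _ hmem

/-- The conjugating homeomorphism of a Lebesgue fair model is the distribution function of the
fair measure of `f`. -/
theorem homeomorph_eq_of_isFair (hf : IsCountablyMarkovMixing f 𝒳)
    (hc : ∀ j, predCount (transitionMatrix f 𝒳) j ≠ 0 ∧ predCount (transitionMatrix f 𝒳) j ≠ ⊤)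
    (hν : ∀ c, ν {c} = 0) (hfν : IsFair f ν) (hφ : StrictMono φ) (hmap : ν.map φ = volume)
    {g : I → I} (hg : IsFair g (volume : Measure I)) {ψ : I ≃ₜ I} (hψ : StrictMono ψ)
    (hconj : g ∘ ψ = ψ ∘ f) (x : I) : ψ x = φ x := by
  -- Lebesgue measure pulled back by `ψ` is fair for `f` and has no atoms, so it is `ν`.
  have hfair := hg.conj ψ.symm.toMeasurableEquiv (T' := f) fun y => by
    have := congrFun hconj (ψ.symm y)
    simp only [Function.comp, Homeomorph.apply_symm_apply] at this
    simp [this]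
  have hnull : ∀ c, volume.map ψ.symm.toMeasurableEquiv {c} = 0 := by
    intro c
    rw [MeasurableEquiv.map_apply]
    have : ψ.symm.toMeasurableEquiv ⁻¹' {c} = {ψ c} := by
      ext y
      simp [Homeomorph.symm_apply_eq]
    rw [this]
    exact measure_singleton _
  have heq := hf.fair_unique hc hfair hfν hnull hν
  have hmapψ : ν.map ψ = volume := by
    rw [← heq, Measure.map_map ψ.measurable (MeasurableEquiv.measurable _)]
    have : (ψ ∘ ψ.symm.toMeasurableEquiv : I → I) = id := by
      ext y; simp
    rw [this, Measure.map_id]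
  exact Subtype.ext ((coe_eq_measureReal_Iic hψ hmapψ x).trans
    (coe_eq_measureReal_Iic hφ hmap x).symm)

theorem hasSum_transitionMatrix (j : partitionIntervals 𝒳)
    (hc : predCount (transitionMatrix f 𝒳) j ≠ ⊤) :
    HasSum (fun k => (transitionMatrix f 𝒳 k j : ℝ))
      ((predCount (transitionMatrix f 𝒳) j).toNat : ℝ) := by
  have hfin : {i | transitionMatrix f 𝒳 i j = 1}.Finite := encard_ne_top_iff.1 hc
  have hsum : ∑ k ∈ hfin.toFinset, (transitionMatrix f 𝒳 k j : ℝ) =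
      ((predCount (transitionMatrix f 𝒳) j).toNat : ℝ) := by
    rw [Finset.sum_congr rfl fun k hk => by
      rw [show transitionMatrix f 𝒳 k j = 1 from hfin.mem_toFinset.1 hk], predCount,
      hfin.encard_eq_coe_toFinset_card]
    simp
  rw [← hsum]
  refine hasSum_sum_of_ne_finset_zero fun k hk => ?_
  have hk' : transitionMatrix f 𝒳 k j ≠ 1 := fun h => hk (hfin.mem_toFinset.2 h)
  have : transitionMatrix f 𝒳 k j = 0 := by
    unfold transitionMatrix at hk' ⊢
    split_ifs at hk' ⊢
    · exact absurd rfl hk'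
    · rfl
  rw [this, Nat.cast_zero]

end IsCountablyMarkovMixing

/-! ### Existence, uniqueness and slopes of the Lebesgue fair model. -/

theorem mainTheorem8 (f : unitInterval → unitInterval) (𝒳 : Set (Set unitInterval))
    (hf : IsCountablyMarkovMixing f 𝒳)
    (π : partitionIntervals 𝒳 → ℝ)
    (P : Matrix (partitionIntervals 𝒳) (partitionIntervals 𝒳) ℝ)
    (μ : Measure (MarkovShift (transitionMatrix f 𝒳)))
    (hμ : IsMarkovMeasure π P μ)
    (hfair : IsFair (shiftMap (transitionMatrix f 𝒳)) μ) :
    ∃ g : unitInterval → unitInterval,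
      -- `g` has the piecewise affine description, and the description determines it
      IsPiecewiseAffineModel f 𝒳 π P g ∧
      (∀ g₁, IsPiecewiseAffineModel f 𝒳 π P g₁ → g₁ = g) ∧
      -- `g` is the unique Lebesgue fair model of `f`
      IsLebesgueFairModel f g ∧
      (∀ g₁, IsLebesgueFairModel f g₁ → g₁ = g) ∧
      -- the pieces are nondegenerate, and the slopes are the (finite) column sums up to sign
      (∀ i j : partitionIntervals 𝒳, ((i : Set unitInterval) ∩ f ⁻¹' j).Nonempty →
        0 < π i * P i j ∧
        ∃ c d : ℝ, HasSum (fun k => (transitionMatrix f 𝒳 k j : ℝ)) c ∧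
          ((StrictMonoOn f (i : Set unitInterval) ∧
              MapsAffinelyOnto g c d
                (pieceStart f 𝒳 π P i j) (pieceStart f 𝒳 π P i j + π i * P i j)
                (cellStart 𝒳 π j) (cellStart 𝒳 π j + π j)) ∨
            (StrictAntiOn f (i : Set unitInterval) ∧
              MapsAffinelyOnto g (-c) d
                (pieceStart f 𝒳 π P i j) (pieceStart f 𝒳 π P i j + π i * P i j)
                (cellStart 𝒳 π j) (cellStart 𝒳 π j + π j)))) := by
  have := hf.countable_intervals
  obtain ⟨-, hc, hrel⟩ := hμ.fair_relation hfair hf.reflTransGen_transition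
  have hν := hf.isAdaptedMeasure_map_codedPoint hμ hfair
  have hfν := hf.isFair_map_codedPoint hμ hfair
  have := hν.isProbabilityMeasure
  obtain ⟨φ, hφ, hmap⟩ :=
    exists_homeomorph_map_eq_volume hν.measure_singleton hν.measure_pos
  have hg : ∀ x, (φ ∘ f ∘ φ.symm) (φ x) = φ (f x) := fun x => by simp
  have hpam := hf.isPiecewiseAffineModel hν hφ hmap hg hc
  refine ⟨φ ∘ f ∘ φ.symm, hpam,
    fun g₁ h₁ => hf.eq_of_isPiecewiseAffineModel hν hφ hmap h₁ hpam, ⟨?_, φ, hφ, funext hg⟩, ?_, ?_⟩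
  · rw [← hmap]
    exact hfν.conj φ.toMeasurableEquiv hg
  · rintro g₁ ⟨hfair₁, ψ, hψ, hconj⟩
    have heq := hf.homeomorph_eq_of_isFair hc hν.measure_singleton hfν hφ hmap hfair₁ hψ hconj
    funext t
    obtain ⟨x, rfl⟩ := φ.surjective t
    rw [hg, ← heq, ← heq]
    exact congrFun hconj x
  · intro i j hij
    have hij' := hf.nonempty_piece_iff.1 hij
    obtain ⟨d, hd⟩ := hf.exists_mapsAffinelyOnto hν hφ hmap hg (hc j) hij'
    exact ⟨(hrel i j hij').1, _, d,
      IsCountablyMarkovMixing.hasSum_transitionMatrix j (hc j).2, hd⟩
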